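/- Let $1\le N_T\le N_R$ be integers, $\Gamma_s>0$, let $R$ (the transmit-covariance matrix, also written $R_{T,K}$) be a Hermitian positive definite $N_T\times N_T$ matrix, and let $h_{d,1}\in\mathbb{C}^{N_R}$. Let $H=(h_1\; H_2)$ be a random complex $N_R\times N_T$ matrix with first column $h_1$ (intended stream) and remaining columns $H_2$ (interfering streams), whose mean is $H_d=(h_{d,1}\; 0)$ and whose rows are independent, each conjugate-transposed row of $H-H_d$ being a circularly-symmetric complex Gaussian vector with mean $0$ and covariance matrix $R$ (Rician fading of the intended stream, Rayleigh fading of the interfering streams, transmit-correlation only). Let $$\gamma_1=\frac{\Gamma_s}{[(H^{\mathcal H}H)^{-1}]_{1,1}}$$ be the zero-forcing SNR of stream 1, and put $$N=N_R-N_T+1,\qquad \Gamma_1=\frac{\Gamma_s}{[R^{-1}]_{1,1}},\qquad a=[R^{-1}]_{1,1}\,\|h_{d,1}\|^2 .$$ 1. Almost surely $H^{\mathcal H}H$ and $H_2^{\mathcal H}H_2$ are invertible and $\gamma_1=\Gamma_s\,h_1^{\mathcal H}Q_2h_1$, where $Q_2=I-H_2(H_2^{\mathcal H}H_2)^{-1}H_2^{\mathcal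 H}$. 2. For every real $s$ with $\Gamma_1 s<1$ the variable $e^{s\gamma_1}$ is integrable and $$\mathbb{E}\,e^{s\gamma_1}=\frac{1}{(1-\Gamma_1 s)^{N}}\;{}_1F_1\!\left(N;\,N_R;\,\frac{a\,\Gamma_1 s}{1-\Gamma_1 s}\right),$$ where ${}_1F_1(b;c;z)=\sum_{n\ge 0}\frac{(b)_n}{(c)_n}\frac{z^n}{n!}$ is the confluent hypergeometric function and $(x)_n=x(x+1)\cdots(x+n-1)$. 3. Consequently, for fixed $N_R,N_T,\Gamma_s$, the law of $\gamma_1$ depends on the mean only through $\|h_{d,1}\|$ and on $R$ only through $[R^{-1}]_{1,1}$: any two such channels (possibly on different probability spaces) with equal $\|h_{d,1}\|$ and equal $[R^{-1}]_{1,1}$ have SNRs with the same law. -/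

import Mathlib

open MeasureTheory ProbabilityTheory
open scoped ComplexOrder

/-- Kummer's confluent hypergeometric function
`₁F₁(b; c; z) = ∑ₙ (b)ₙ / (c)ₙ * zⁿ / n!`, where `(x)ₙ` is the Pochhammer symbol. -/
noncomputable def kummer1F1 (b c z : ℝ) : ℝ :=
  ∑' n : ℕ, (ascPochhammer ℝ n).eval b / (ascPochhammer ℝ n).eval c * (z ^ n / (n.factorial : ℝ))

/-- `X ∼ 𝒞𝒩(m, R)`: `X` is a circularly-symmetric complex Gaussian random vector with mean `m` and
covariance matrix `R`. -/
structure IsCircularGaussian {Ω ι : Type*} [MeasurableSpace Ω] [Fintype ι] (P : Measure Ω)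
    (X : Ω → ι → ℂ) (m : ι → ℂ) (R : Matrix ι ι ℂ) : Prop where
  /-- the real and imaginary parts of all entries are jointly Gaussian -/
  gaussian : HasGaussianLaw X P
  /-- `𝔼[X] = m` -/
  mean : ∀ j, ∫ ω, X ω j ∂P = m j
  /-- `𝔼[(X - m) (X - m)ᴴ] = R` -/
  cov : ∀ j k, ∫ ω, (X ω j - m j) * star (X ω k - m k) ∂P = R j k
  /-- `e^{iθ} (X - m)` has the same law as `X - m` -/
  circular : ∀ θ : ℝ,
    P.map (fun ω j => Complex.exp (θ * Complex.I) * (X ω j - m j)) =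
      P.map (fun ω j => X ω j - m j)

/-- The random matrix `H` is a complex Gaussian channel (rows: receive antennas, columns: transmitted
streams) with mean `Hd`, zero receive-correlation and transmit-covariance `R`: the rows of `H` are
independent, and each conjugate-transposed row of `H - Hd` is `𝒞𝒩(0, R)`, that is, each
conjugate-transposed row of `H` is `𝒞𝒩` with covariance `R` and mean the conjugate-transposed row
of `Hd`. -/
structure IsGaussianChannel {Ω : Type*} [MeasurableSpace Ω] {NR NT : ℕ} (P : Measure Ω)
    (H : Ω → Matrix (Fin NR) (Fin NT) ℂ) (Hd : Matrix (Fin NR) (Fin NT) ℂ)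
    (R : Matrix (Fin NT) (Fin NT) ℂ) : Prop where
  indep : iIndepFun (fun (i : Fin NR) (ω : Ω) (j : Fin NT) => H ω i j) P
  row : ∀ i : Fin NR,
    IsCircularGaussian P (fun ω j => star (H ω i j)) (fun j => star (Hd i j)) R

/-- The channel matrix `H₂` of the interfering streams (all columns except the first). -/
def interferers {NR NT : ℕ} [NeZero NT] (H : Matrix (Fin NR) (Fin NT) ℂ) :
    Matrix (Fin NR) {j : Fin NT // j ≠ 0} ℂ :=
  H.submatrix id Subtype.val

/-- `Q₂ = I - H₂ (H₂ᴴ H₂)⁻¹ H₂ᴴ`. -/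
noncomputable def projQ₂ {NR NT : ℕ} [NeZero NT] (H : Matrix (Fin NR) (Fin NT) ℂ) :
    Matrix (Fin NR) (Fin NR) ℂ :=
  1 - interferers H * ((interferers H).conjTranspose * interferers H)⁻¹ *
    (interferers H).conjTranspose

/-- The zero-forcing SNR of the first stream, `γ₁ = Γs / [(Hᴴ H)⁻¹]₁₁`. -/
noncomputable def zfSNR {NR NT : ℕ} [NeZero NT] (Γs : ℝ) (H : Matrix (Fin NR) (Fin NT) ℂ) : ℝ :=
  Γs / ((H.conjTranspose * H)⁻¹ 0 0).re

/-! The Schur complement identity 1/[(HᴴH)⁻¹]₁₁ = h₁ᴴQ₂h₁ makes the SNR Γs times the squared length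
of h₁ projected off the span of the interferers (`zfSNR_eq_hermForm`). The inverses exist almost
surely because Gaussian rows with definite covariance do not charge hyperplanes
(`ae_linearIndependent_pi`).

The randomness of h₁ is split by regression. Let w be the first column of R⁻¹ scaled so that w₁ = 1;
then Rw = c e₁ with c = 1/[R⁻¹]₁₁. The innovation e = (H - H_d)w has independent 𝒞𝒩(0, c) entries
and, being uncorrelated with H₂, is independent of it. Moreover h₁ differs from h_{d,1} + e by a
combination of columns of H₂, which Q₂ annihilates. So γ₁ = Γs ‖Q₂(h_{d,1} + e)‖² with e and Q₂
independent.

For fixed Q₂, a projection of rank N, diagonalisation reduces the integral over e to one-dimensional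
Gaussian integrals, giving (1 - Γ₁s)⁻ᴺ exp(t ‖Q₂h_{d,1}‖²) with t = Γs s/(1 - Γ₁s)
(`exp_hermForm_gaussianVector`). It remains to average over Q₂. The law of H₂ is invariant under
left multiplication by unitaries, so E‖Q₂x‖²ⁿ = cₙ‖x‖²ⁿ. Averaging this over a standard Gaussian x
identifies cₙ as a ratio of Gamma moments, (N)ₙ/(N_R)ₙ (`integral_hermForm_pow_of_isotropic`), and
summing the exponential series gives ₁F₁.

The moment-generating function is finite near 0 and involves the channel only through [R⁻¹]₁₁ and
‖h_{d,1}‖, and it determines the law (`map_eq_of_mgf_eventuallyEq`). -/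

open Matrix
open scoped NNReal

set_option linter.unusedSectionVars false

/-! ### Hermitian projections and unitary changes of coordinates. -/

section LinearAlgebra

variable {ι κ : Type*} [Fintype ι] [DecidableEq ι] [Fintype κ] [DecidableEq κ]

/-- The orthogonal projection `I - Z (Zᴴ Z)⁻¹ Zᴴ` onto the complement of the range of `Z`. -/
noncomputable def residualProj (Z : Matrix ι κ ℂ) : Matrix ι ι ℂ :=
  1 - Z * (Zᴴ * Z)⁻¹ * Zᴴ

/-- The Hermitian form `xᴴ Q x`. -/
noncomputable def hermForm (Q : Matrix ι ι ℂ) (x : ι → ℂ) : ℝ := (star x ⬝ᵥ Q *ᵥ x).re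

/-- The squared Euclidean norm. -/
noncomputable def sqNorm (x : ι → ℂ) : ℝ := ∑ i, Complex.normSq (x i)

lemma sqNorm_eq_norm (x : ι → ℂ) : sqNorm x = ‖WithLp.toLp 2 x‖ ^ 2 := by
  rw [EuclideanSpace.norm_sq_eq]
  simp [sqNorm, Complex.normSq_eq_norm_sq]

lemma sqNorm_nonneg (x : ι → ℂ) : 0 ≤ sqNorm x :=
  Finset.sum_nonneg fun _ _ => Complex.normSq_nonneg _

lemma dotProduct_star_self_eq (x : ι → ℂ) : star x ⬝ᵥ x = (sqNorm x : ℂ) := by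
  simp [sqNorm, dotProduct, Complex.normSq_eq_conj_mul_self]

lemma residualProj_isHermitian (Z : Matrix ι κ ℂ) : (residualProj Z).IsHermitian := by
  have h : ((Zᴴ * Z)⁻¹)ᴴ = (Zᴴ * Z)⁻¹ := by
    rw [conjTranspose_nonsing_inv, conjTranspose_mul, conjTranspose_conjTranspose]
  simp [residualProj, IsHermitian, conjTranspose_sub, conjTranspose_mul, h, Matrix.mul_assoc]

lemma residualProj_mul_self (Z : Matrix ι κ ℂ) :
    residualProj Z * residualProj Z = residualProj Z := by
  by_cases h : IsUnit (Zᴴ * Z).det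
  · have h1 : Z * (Zᴴ * Z)⁻¹ * Zᴴ * (Z * (Zᴴ * Z)⁻¹ * Zᴴ) = Z * (Zᴴ * Z)⁻¹ * Zᴴ := by
      calc _ = Z * ((Zᴴ * Z)⁻¹ * (Zᴴ * Z)) * (Zᴴ * Z)⁻¹ * Zᴴ := by
            simp only [Matrix.mul_assoc]
        _ = _ := by rw [nonsing_inv_mul _ h, Matrix.mul_one]
    simp [residualProj, sub_mul, mul_sub, h1]
  -- A singular Gram matrix has inverse 0 by convention, so the projection is then the identity;
  -- idempotence needs no rank condition.
  · simp [residualProj, nonsing_inv_apply_not_isUnit _ h]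

lemma residualProj_mul (Z : Matrix ι κ ℂ) (h : IsUnit (Zᴴ * Z).det) : residualProj Z * Z = 0 := by
  rw [residualProj, Matrix.sub_mul, Matrix.mul_assoc _ Zᴴ Z, Matrix.mul_assoc Z,
    nonsing_inv_mul _ h]
  simp

lemma trace_residualProj (Z : Matrix ι κ ℂ) (h : IsUnit (Zᴴ * Z).det) :
    (residualProj Z).trace = (Fintype.card ι : ℂ) - Fintype.card κ := by
  rw [residualProj, trace_sub, Matrix.trace_mul_comm, ← Matrix.mul_assoc,
    mul_nonsing_inv _ h, trace_one, trace_one]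

lemma residualProj_unitary_mul {U : Matrix ι ι ℂ} (hU : U ∈ unitaryGroup ι ℂ)
    (Z : Matrix ι κ ℂ) : residualProj (U * Z) = U * residualProj Z * Uᴴ := by
  have h1 : Uᴴ * U = 1 := mem_unitaryGroup_iff'.1 hU
  have h2 : U * Uᴴ = 1 := mem_unitaryGroup_iff.1 hU
  have h3 : (U * Z)ᴴ * (U * Z) = Zᴴ * Z := by
    rw [conjTranspose_mul, Matrix.mul_assoc, ← Matrix.mul_assoc Uᴴ, h1, Matrix.one_mul]
  rw [residualProj, h3, residualProj, Matrix.mul_sub, Matrix.sub_mul, Matrix.mul_one, h2,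
    conjTranspose_mul]
  simp only [Matrix.mul_assoc]

lemma hermForm_conj (U Q : Matrix ι ι ℂ) (x : ι → ℂ) :
    hermForm (U * Q * Uᴴ) x = hermForm Q (Uᴴ *ᵥ x) := by
  rw [hermForm, hermForm, star_mulVec, conjTranspose_conjTranspose, ← mulVec_mulVec,
    ← mulVec_mulVec, dotProduct_mulVec]

lemma hermForm_eq_sqNorm {Q : Matrix ι ι ℂ} (hQ : Q.IsHermitian) (hQ2 : Q * Q = Q) (x : ι → ℂ) :
    star x ⬝ᵥ Q *ᵥ x = (sqNorm (Q *ᵥ x) : ℂ) := by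
  rw [← dotProduct_star_self_eq, star_mulVec, hQ.eq, ← dotProduct_mulVec, mulVec_mulVec, hQ2]

lemma ofReal_hermForm {Q : Matrix ι ι ℂ} (hQ : Q.IsHermitian) (hQ2 : Q * Q = Q) (x : ι → ℂ) :
    (hermForm Q x : ℂ) = star x ⬝ᵥ Q *ᵥ x := by
  rw [hermForm, hermForm_eq_sqNorm hQ hQ2, Complex.ofReal_re]

lemma hermForm_nonneg {Q : Matrix ι ι ℂ} (hQ : Q.IsHermitian) (hQ2 : Q * Q = Q) (x : ι → ℂ) :
    0 ≤ hermForm Q x := by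
  rw [hermForm, hermForm_eq_sqNorm hQ hQ2]; exact sqNorm_nonneg _

lemma hermForm_one (x : ι → ℂ) : hermForm 1 x = sqNorm x := by
  rw [hermForm, one_mulVec, dotProduct_star_self_eq, Complex.ofReal_re]

lemma hermForm_le {Q : Matrix ι ι ℂ} (hQ : Q.IsHermitian) (hQ2 : Q * Q = Q) (x : ι → ℂ) :
    hermForm Q x ≤ sqNorm x := by
  have h := hermForm_nonneg (Q := 1 - Q) (isHermitian_one.sub hQ)
    (by simp [sub_mul, mul_sub, hQ2]) x
  rw [← hermForm_one]
  simp only [hermForm, sub_mulVec, dotProduct_sub, Complex.sub_re] at h ⊢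
  linarith

lemma hermForm_smul (Q : Matrix ι ι ℂ) (c : ℝ) (x : ι → ℂ) :
    hermForm Q ((c : ℂ) • x) = c ^ 2 * hermForm Q x := by
  rw [hermForm, hermForm, mulVec_smul, star_smul, dotProduct_smul, smul_dotProduct]
  simp
  ring

lemma sqNorm_unitary_mulVec {U : Matrix ι ι ℂ} (hU : U ∈ unitaryGroup ι ℂ) (x : ι → ℂ) :
    sqNorm (U *ᵥ x) = sqNorm x := by
  have h1 : Uᴴ * U = 1 := mem_unitaryGroup_iff'.1 hU
  have := dotProduct_star_self_eq (U *ᵥ x)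
  rw [star_mulVec, ← dotProduct_mulVec, mulVec_mulVec, h1, one_mulVec,
    dotProduct_star_self_eq] at this
  exact_mod_cast this.symm

/-- A Hermitian projection is, up to a unitary change of coordinates, a coordinate projection. -/
lemma exists_unitary_hermForm_eq_sum {Q : Matrix ι ι ℂ} (hQ : Q.IsHermitian) (hQ2 : Q * Q = Q) :
    ∃ U ∈ unitaryGroup ι ℂ, ∃ S : Finset ι, (S.card : ℂ) = Q.trace ∧
      ∀ x, hermForm Q x = ∑ i ∈ S, Complex.normSq ((U *ᵥ x) i) := by
  have hspec := hQ.spectral_theorem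
  set V : Matrix ι ι ℂ := (hQ.eigenvectorUnitary : Matrix ι ι ℂ) with hV
  have hVm : V ∈ unitaryGroup ι ℂ := hQ.eigenvectorUnitary.2
  have hd : Q = V * diagonal (fun i => (hQ.eigenvalues i : ℂ)) * Vᴴ := by
    conv_lhs => rw [hspec]
    rw [Unitary.conjStarAlgAut_apply]
    rfl
  have h1 : Vᴴ * V = 1 := mem_unitaryGroup_iff'.1 hVm
  have hD : Vᴴ * Q * V = diagonal (fun i => (hQ.eigenvalues i : ℂ)) := by
    conv_lhs => rw [hd]
    calc _ = (Vᴴ * V) * diagonal (fun i => (hQ.eigenvalues i : ℂ)) * (Vᴴ * V) := by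
          simp only [Matrix.mul_assoc]
      _ = _ := by rw [h1, Matrix.one_mul, Matrix.mul_one]
  have h2 : V * Vᴴ = 1 := mem_unitaryGroup_iff.1 hVm
  have hDD : diagonal (fun i => (hQ.eigenvalues i : ℂ)) * diagonal (fun i => (hQ.eigenvalues i : ℂ))
      = diagonal (fun i => (hQ.eigenvalues i : ℂ)) := by
    rw [← hD]
    calc _ = Vᴴ * Q * (V * Vᴴ) * Q * V := by simp only [Matrix.mul_assoc]
      _ = _ := by rw [h2, Matrix.mul_one, Matrix.mul_assoc Vᴴ, hQ2]
  -- Idempotence forces the eigenvalues into {0, 1}, so the trace counts the eigenvalues equal to 1.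
  have h01 : ∀ i, hQ.eigenvalues i = 0 ∨ hQ.eigenvalues i = 1 := by
    intro i
    rw [diagonal_mul_diagonal] at hDD
    have := congrFun (diagonal_injective hDD) i
    have h' : hQ.eigenvalues i * hQ.eigenvalues i = hQ.eigenvalues i := by exact_mod_cast this
    rcases eq_or_ne (hQ.eigenvalues i) 0 with h | h
    · exact Or.inl h
    · exact Or.inr (mul_left_cancel₀ h (by linarith))
  refine ⟨Vᴴ, ?_, Finset.univ.filter fun i => hQ.eigenvalues i = 1, ?_, fun x => ?_⟩
  · rw [mem_unitaryGroup_iff]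
    simpa [star_eq_conjTranspose] using h1
  · rw [hQ.trace_eq_sum_eigenvalues, Finset.card_filter, Nat.cast_sum]
    refine Finset.sum_congr rfl fun i _ => ?_
    rcases h01 i with h | h <;> simp [h]
  · conv_lhs => rw [hd]
    rw [hermForm_conj, Finset.sum_filter, hermForm, dotProduct, Complex.re_sum]
    refine Finset.sum_congr rfl fun i _ => ?_
    rw [mulVec_diagonal]
    rcases h01 i with h | h
    · simp [h]
    · simp [h, Complex.normSq_apply]

/-- The unitary group acts transitively on spheres. -/
lemma exists_unitary_mulVec_eq_single (i₀ : ι) (x : ι → ℂ) :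
    ∃ U ∈ unitaryGroup ι ℂ, U *ᵥ x = ((Real.sqrt (sqNorm x) : ℝ) : ℂ) • Pi.single i₀ 1 := by
  by_cases hx : x = 0
  · exact ⟨1, one_mem _, by simp [hx, sqNorm]⟩
  set y : EuclideanSpace ℂ ι := WithLp.toLp 2 x with hy
  have hs : Real.sqrt (sqNorm x) = ‖y‖ := by
    rw [sqNorm_eq_norm, Real.sqrt_sq (norm_nonneg _)]
  have hy0 : ‖y‖ ≠ 0 := by
    rw [norm_ne_zero_iff]; intro h; exact hx (by simpa [hy] using congrArg WithLp.ofLp h)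
  -- Only the value at `i₀` matters: the normalised vector is extended to an orthonormal basis,
  -- whose conjugates form the rows of the unitary.
  let v : ι → EuclideanSpace ℂ ι := fun _ => (‖y‖⁻¹ : ℂ) • y
  have hv : Orthonormal ℂ (({i₀} : Set ι).domRestrict v) := by
    refine ⟨fun i => ?_, fun i j hij => absurd (Subsingleton.elim i j) hij⟩
    change ‖(‖y‖⁻¹ : ℂ) • y‖ = 1
    simp [norm_smul, hy0]
  obtain ⟨b, hb⟩ := hv.exists_orthonormalBasis_extension_of_card_eq (by simp)
  have hb0 : y = (‖y‖ : ℂ) • b i₀ := by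
    rw [hb i₀ rfl, smul_smul, mul_inv_cancel₀ (by exact_mod_cast hy0), one_smul]
  refine ⟨Matrix.of fun i j => star (b i j), ?_, ?_⟩
  · rw [mem_unitaryGroup_iff]
    ext i j
    have h := orthonormal_iff_ite.1 b.orthonormal i j
    rw [PiLp.inner_apply] at h
    rw [Matrix.mul_apply, Matrix.one_apply, ← h]
    simp [mul_comm]
  · ext i
    have h := orthonormal_iff_ite.1 b.orthonormal i i₀
    have h2 : inner ℂ (b i) y = (‖y‖ : ℂ) * if i = i₀ then 1 else 0 := by
      rw [hb0, inner_smul_right, h, ← hb0]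
    rw [PiLp.inner_apply] at h2
    rw [hs, Pi.smul_apply, Pi.single_apply, smul_eq_mul, ← h2]
    simp [mulVec, dotProduct, hy, mul_comm]

end LinearAlgebra

/-! ### Almost sure full rank. -/

section FullRank

/-- Fewer than `n` vectors span a proper subspace, which lies in the kernel of a nonzero functional.
-/
lemma exists_dotProduct_eq_zero_of_mem_span {n k : ℕ} (hk : k < n) {w : Fin k → Fin n → ℂ}
    (hw : LinearIndependent ℂ w) :
    ∃ v : Fin n → ℂ, v ≠ 0 ∧ ∀ x ∈ Submodule.span ℂ (Set.range w), v ⬝ᵥ x = 0 := by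
  have hlt : Submodule.span ℂ (Set.range w) < ⊤ := by
    refine lt_top_iff_ne_top.2 fun htop => ?_
    have h1 := finrank_span_eq_card hw
    rw [htop, finrank_top] at h1
    simp at h1
    omega
  obtain ⟨f, hf0, hf⟩ := Submodule.exists_le_ker_of_lt_top _ hlt
  have hfv : ∀ x, f x = (fun i => f (Pi.single i 1)) ⬝ᵥ x := fun x => by
    conv_lhs => rw [← Finset.univ_sum_single x]
    rw [map_sum]
    refine Finset.sum_congr rfl fun i _ => ?_
    rw [show (Pi.single i (x i) : Fin n → ℂ) = x i • Pi.single i 1 by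
      rw [← Pi.single_smul]; simp, map_smul, smul_eq_mul, mul_comm]
  refine ⟨fun i => f (Pi.single i 1),
    fun h0 => hf0 (LinearMap.ext fun x => by rw [hfv, h0]; simp), fun x hx => ?_⟩
  rw [← hfv]
  exact hf hx

lemma measurableSet_linearIndependent_cons (n k : ℕ) :
    MeasurableSet {p : (Fin k → Fin n → ℂ) × (Fin n → ℂ) |
      LinearIndependent ℂ (Fin.cons p.2 p.1 : Fin (k + 1) → Fin n → ℂ)} := by
  have hc : Continuous fun p : (Fin k → Fin n → ℂ) × (Fin n → ℂ) =>
      (Fin.cons p.2 p.1 : Fin (k + 1) → Fin n → ℂ) := by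
    refine continuous_pi fun i => Fin.cases ?_ (fun j => ?_) i
    · exact continuous_snd
    · exact (continuous_apply j).comp continuous_fst
  exact ((isOpen_setOfPred_linearIndependent (𝕜 := ℂ) (E := Fin n → ℂ)).preimage hc).measurableSet

lemma ae_linearIndependent_cons {n k : ℕ} (hk : k < n) (μ : Measure (Fin n → ℂ))
    [IsProbabilityMeasure μ] (ν : Measure (Fin k → Fin n → ℂ)) [IsProbabilityMeasure ν]
    (hμ : ∀ v : Fin n → ℂ, v ≠ 0 → μ {x | v ⬝ᵥ x = 0} = 0)
    (hν : ∀ᵐ w ∂ν, LinearIndependent ℂ w) :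
    ∀ᵐ p ∂μ.prod ν, LinearIndependent ℂ (Fin.cons p.1 p.2 : Fin (k + 1) → Fin n → ℂ) := by
  -- Fubini with the old vectors fixed first: the new one only has to avoid a hyperplane containing
  -- their span.
  have hswap : ∀ᵐ p ∂ν.prod μ,
      LinearIndependent ℂ (Fin.cons p.2 p.1 : Fin (k + 1) → Fin n → ℂ) := by
    refine (Measure.ae_prod_iff_ae_ae (measurableSet_linearIndependent_cons n k)).2 ?_
    filter_upwards [hν] with w hw
    obtain ⟨v, hv0, hv⟩ := exists_dotProduct_eq_zero_of_mem_span hk hw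
    have hnull : ∀ᵐ x ∂μ, ¬ v ⬝ᵥ x = 0 := by
      rw [ae_iff]
      simpa using hμ v hv0
    filter_upwards [hnull] with x hx
    rw [linearIndependent_finCons]
    exact ⟨hw, fun hmem => hx (hv x hmem)⟩
  exact (Measure.measurePreserving_swap (μ := μ) (ν := ν)).quasiMeasurePreserving.ae hswap

/-- Independent random vectors whose laws do not charge hyperplanes are almost surely linearly
independent, as long as there are no more of them than the dimension. -/
lemma ae_linearIndependent_pi {n : ℕ} : ∀ {k : ℕ} (_ : k ≤ n) (μ : Fin k → Measure (Fin n → ℂ))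
    [∀ i, IsProbabilityMeasure (μ i)]
    (_ : ∀ i, ∀ v : Fin n → ℂ, v ≠ 0 → μ i {x | v ⬝ᵥ x = 0} = 0),
    ∀ᵐ x ∂Measure.pi μ, LinearIndependent ℂ x := by
  intro k
  induction k with
  | zero => exact fun _ μ _ _ => Filter.Eventually.of_forall fun x => linearIndependent_empty_type
  | succ k ih =>
    intro hk μ _ h
    have hν := ih (by omega) (fun j => μ (Fin.succAbove 0 j)) (fun i => h _)
    have key := ae_linearIndependent_cons (by omega) (μ 0) _ (h 0) hν
    filter_upwards [(measurePreserving_piFinSuccAbove μ 0).quasiMeasurePreserving.ae key] with x hx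
    have hx' : (Fin.cons (MeasurableEquiv.piFinSuccAbove (fun _ => Fin n → ℂ) 0 x).1
      (MeasurableEquiv.piFinSuccAbove (fun _ => Fin n → ℂ) 0 x).2 :
        Fin (k + 1) → Fin n → ℂ) = x := by
      funext i
      refine Fin.cases ?_ (fun j => ?_) i
      · rfl
      · rfl
    rwa [hx'] at hx

/-- A matrix some of whose rows are a basis has an invertible Gram matrix. -/
lemma isUnit_det_gram_of_rows {m n : ℕ} (hmn : n ≤ m) (A : Matrix (Fin m) (Fin n) ℂ)
    (h : LinearIndependent ℂ fun i : Fin n => A (Fin.castLE hmn i)) :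
    IsUnit (Aᴴ * A).det := by
  have h1 : IsUnit (A.submatrix (Fin.castLE hmn) id) := linearIndependent_rows_iff_isUnit.1 h
  rw [← isUnit_iff_isUnit_det]
  refine (Matrix.PosDef.conjTranspose_mul_self A ?_).isUnit
  intro x y hxy
  refine mulVec_injective_of_isUnit h1 ?_
  ext i
  exact congrFun hxy (Fin.castLE hmn i)

lemma isUnit_det_gram_submatrix {m n κ : Type*} [Fintype m] [Fintype n] [DecidableEq n]
    [Fintype κ] [DecidableEq κ] (A : Matrix m n ℂ) (h : IsUnit (Aᴴ * A).det)
    (f : κ → n) (hf : Function.Injective f) :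
    IsUnit ((A.submatrix id f)ᴴ * A.submatrix id f).det := by
  have hinj : (Aᴴ * A).PosDef := by
    refine (posSemidef_conjTranspose_mul_self A).posDef_iff_isUnit.2 ?_
    rwa [isUnit_iff_isUnit_det]
  rw [← isUnit_iff_isUnit_det]
  have h2 := hinj.submatrix hf
  have h3 : (A.submatrix id f)ᴴ * A.submatrix id f = (Aᴴ * A).submatrix f f := by
    ext i j; simp [Matrix.mul_apply]
  rw [h3]
  exact h2.isUnit

end FullRank

/-! ### Exponential of a square under a real Gaussian law. -/

section GaussianReal

/-- Completing the square; the condition on `u` makes the remaining quadratic term negative. -/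
lemma mul_sq_sub_sq_div_eq {v u m x : ℝ} (hv : 0 < v) (h : 2 * u * v < 1) :
    u * (m + x) ^ 2 - x ^ 2 / (2 * v) =
      u * m ^ 2 / (1 - 2 * u * v) +
        -((1 - 2 * u * v) / (2 * v)) * (x - 2 * u * v * m / (1 - 2 * u * v)) ^ 2 := by
  obtain ⟨d, hd⟩ : ∃ d, d = 1 - 2 * u * v := ⟨_, rfl⟩
  have h1 : d ≠ 0 := by linarith
  rw [← hd]
  field_simp
  rw [hd]
  ring

lemma gaussianPDFReal_mul_exp_mul_sq {v : ℝ≥0} (hv : v ≠ 0) {u : ℝ} (h : 2 * u * v < 1)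
    (m x : ℝ) :
    gaussianPDFReal 0 v x * Real.exp (u * (m + x) ^ 2) =
      (Real.sqrt (2 * Real.pi * v))⁻¹ * Real.exp (u * m ^ 2 / (1 - 2 * u * v)) *
        Real.exp (-((1 - 2 * u * v) / (2 * v)) * (x - 2 * u * v * m / (1 - 2 * u * v)) ^ 2) := by
  have hv' : (0 : ℝ) < v := by positivity
  rw [gaussianPDFReal, mul_assoc, ← Real.exp_add, mul_assoc (Real.sqrt _)⁻¹, ← Real.exp_add,
    ← mul_sq_sub_sq_div_eq hv' h]
  congr 2
  ring

lemma integrable_exp_mul_sq_gaussianReal {v : ℝ≥0} (hv : v ≠ 0) {u : ℝ} (h : 2 * u * v < 1)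
    (m : ℝ) : Integrable (fun x => Real.exp (u * (m + x) ^ 2)) (gaussianReal 0 v) := by
  have hv' : (0 : ℝ) < v := by positivity
  have hb : 0 < (1 - 2 * u * v) / (2 * v) := div_pos (by linarith) (by linarith)
  rw [gaussianReal_of_var_ne_zero _ hv, gaussianPDF_def,
    integrable_withDensity_iff_integrable_smul₀' (by fun_prop)
      (Filter.Eventually.of_forall fun _ => ENNReal.ofReal_lt_top)]
  simp only [ENNReal.toReal_ofReal (gaussianPDFReal_nonneg _ _ _), smul_eq_mul,
    gaussianPDFReal_mul_exp_mul_sq hv h]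
  exact ((integrable_exp_neg_mul_sq hb).comp_sub_right _).const_mul _

lemma integral_exp_mul_sq_gaussianReal {v : ℝ≥0} (hv : v ≠ 0) {u : ℝ} (h : 2 * u * v < 1)
    (m : ℝ) : ∫ x, Real.exp (u * (m + x) ^ 2) ∂gaussianReal 0 v =
      (Real.sqrt (1 - 2 * u * v))⁻¹ * Real.exp (u * m ^ 2 / (1 - 2 * u * v)) := by
  have hv' : (0 : ℝ) < v := by positivity
  have h0 : 0 < 1 - 2 * u * v := by linarith
  rw [integral_gaussianReal_eq_integral_smul hv]
  simp only [smul_eq_mul, gaussianPDFReal_mul_exp_mul_sq hv h]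
  rw [integral_const_mul, integral_sub_right_eq_self (fun x : ℝ => Real.exp
    (-((1 - 2 * u * v) / (2 * v)) * x ^ 2)), integral_gaussian, mul_right_comm]
  congr 1
  rw [← Real.sqrt_inv, ← Real.sqrt_inv, ← Real.sqrt_mul (by positivity)]
  congr 1
  field_simp

end GaussianReal

/-! ### The scalar circular Gaussian law. -/

section ComplexGaussian

/-- The circularly-symmetric complex Gaussian law with mean zero and variance `v`. -/
noncomputable def complexGaussian (v : ℝ≥0) : Measure ℂ :=
  ((gaussianReal 0 (v / 2)).prod (gaussianReal 0 (v / 2))).map Complex.measurableEquivRealProd.symm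

instance (v : ℝ≥0) : IsProbabilityMeasure (complexGaussian v) :=
  Measure.isProbabilityMeasure_map Complex.measurableEquivRealProd.symm.measurable.aemeasurable

lemma integral_complexGaussian {E : Type*} [NormedAddCommGroup E] [NormedSpace ℝ E] (v : ℝ≥0)
    (f : ℂ → E) : ∫ z, f z ∂complexGaussian v =
      ∫ p : ℝ × ℝ, f ⟨p.1, p.2⟩ ∂(gaussianReal 0 (v / 2)).prod (gaussianReal 0 (v / 2)) := by
  rw [complexGaussian, integral_map_equiv]
  rfl

lemma integral_cexp_complexGaussian (v : ℝ≥0) (a : ℂ) :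
    ∫ z, Complex.exp ((a * z).re * Complex.I) ∂complexGaussian v =
      Complex.exp (-(v / 4 * Complex.normSq a)) := by
  have hc : ∀ t : ℝ, ∫ x : ℝ, Complex.exp (t * x * Complex.I) ∂gaussianReal 0 (v / 2) =
      Complex.exp (-(v / 4 * t ^ 2)) := fun t => by
    rw [← charFun_apply_real, charFun_gaussianReal]
    congr 1
    push_cast
    ring
  have h1 : ∀ p : ℝ × ℝ, Complex.exp ((a * (⟨p.1, p.2⟩ : ℂ)).re * Complex.I) =
      Complex.exp (a.re * p.1 * Complex.I) * Complex.exp ((-a.im : ℝ) * p.2 * Complex.I) := by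
    intro p
    rw [← Complex.exp_add]
    congr 1
    simp only [Complex.mul_re]
    push_cast
    ring
  rw [integral_complexGaussian]
  simp only [h1]
  rw [integral_prod_mul (fun x : ℝ => Complex.exp (a.re * x * Complex.I))
    (fun y : ℝ => Complex.exp ((-a.im : ℝ) * y * Complex.I)), hc, hc, ← Complex.exp_add,
    Complex.normSq_apply]
  congr 1
  push_cast
  ring

lemma integrable_exp_mul_normSq_complexGaussian {v : ℝ≥0} (hv : v ≠ 0) {u : ℝ} (h : u * v < 1)
    (m : ℂ) :
    Integrable (fun z => Real.exp (u * Complex.normSq (m + z))) (complexGaussian v) := by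
  have h' : 2 * u * ((v / 2 : ℝ≥0) : ℝ) < 1 := by push_cast; linarith
  have hv' : v / 2 ≠ 0 := by positivity
  rw [complexGaussian, integrable_map_equiv]
  convert (integrable_exp_mul_sq_gaussianReal hv' h' m.re).mul_prod
    (integrable_exp_mul_sq_gaussianReal hv' h' m.im) using 1
  funext p
  rw [← Real.exp_add]
  simp [Complex.normSq_apply, Complex.measurableEquivRealProd]
  ring

lemma integral_exp_mul_normSq_complexGaussian {v : ℝ≥0} (hv : v ≠ 0) {u : ℝ} (h : u * v < 1)
    (m : ℂ) : ∫ z, Real.exp (u * Complex.normSq (m + z)) ∂complexGaussian v =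
      (1 - u * v)⁻¹ * Real.exp (u * Complex.normSq m / (1 - u * v)) := by
  have h' : 2 * u * ((v / 2 : ℝ≥0) : ℝ) < 1 := by push_cast; linarith
  have hv' : v / 2 ≠ 0 := by positivity
  have h1 : ∀ p : ℝ × ℝ, Real.exp (u * Complex.normSq (m + (⟨p.1, p.2⟩ : ℂ))) =
      Real.exp (u * (m.re + p.1) ^ 2) * Real.exp (u * (m.im + p.2) ^ 2) := fun p => by
    rw [← Real.exp_add]
    congr 1
    simp [Complex.normSq_apply]
    ring
  have h2 : 2 * u * ((v / 2 : ℝ≥0) : ℝ) = u * v := by push_cast; ring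
  rw [integral_complexGaussian]
  simp only [h1]
  rw [integral_prod_mul (fun x : ℝ => Real.exp (u * (m.re + x) ^ 2))
    (fun y : ℝ => Real.exp (u * (m.im + y) ^ 2)), integral_exp_mul_sq_gaussianReal hv' h',
    integral_exp_mul_sq_gaussianReal hv' h', h2, mul_mul_mul_comm, ← mul_inv,
    Real.mul_self_sqrt (by linarith), ← Real.exp_add, Complex.normSq_apply]
  congr 2
  ring

end ComplexGaussian

/-! ### White complex Gaussian vectors and characteristic functions. -/

section GaussianVector

variable {ι : Type*} [Fintype ι] [DecidableEq ι]

lemma exists_dual_eq_re_dotProduct (L : StrongDual ℝ (ι → ℂ)) :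
    ∃ a : ι → ℂ, ∀ x, L x = (a ⬝ᵥ x).re := by
  -- Since Re((p - qi)(x + yi)) = px + qy, the coefficient has real part L(eᵢ) and imaginary part
  -- -L(i eᵢ).
  refine ⟨fun i => ((L (Pi.single i (1 : ℂ)) : ℝ) : ℂ) -
      (L (Pi.single i Complex.I) : ℝ) * Complex.I, fun x => ?_⟩
  conv_lhs => rw [← Finset.univ_sum_single x]
  rw [map_sum, dotProduct, Complex.re_sum]
  refine Finset.sum_congr rfl fun i _ => ?_
  have h1 : (Pi.single i (x i) : ι → ℂ) = (x i).re • (Pi.single i (1 : ℂ) : ι → ℂ) +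
      (x i).im • (Pi.single i Complex.I : ι → ℂ) := by
    rw [← Pi.single_smul, ← Pi.single_smul, ← Pi.single_add]
    congr 1
    simp
  rw [h1, map_add, map_smul, map_smul]
  simp
  ring

/-- Measures on `ℂ^ι` are determined by their characteristic functions. -/
lemma measure_ext_of_integral_cexp_re {μ ν : Measure (ι → ℂ)} [IsFiniteMeasure μ]
    [IsFiniteMeasure ν]
    (h : ∀ a : ι → ℂ, ∫ x, Complex.exp ((a ⬝ᵥ x).re * Complex.I) ∂μ =
      ∫ x, Complex.exp ((a ⬝ᵥ x).re * Complex.I) ∂ν) : μ = ν := by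
  refine Measure.ext_of_charFunDual ?_
  funext L
  obtain ⟨a, ha⟩ := exists_dual_eq_re_dotProduct L
  simp only [charFunDual_apply, ha]
  exact h a

@[fun_prop]
lemma measurable_dotProduct (a : ι → ℂ) : Measurable fun x : ι → ℂ => a ⬝ᵥ x := by
  simp only [dotProduct]
  fun_prop

lemma indepFun_of_integral_cexp_re {κ Ω : Type*} [Fintype κ] [DecidableEq κ] [MeasurableSpace Ω]
    {P : Measure Ω} [IsProbabilityMeasure P] {X : Ω → ι → ℂ} {Y : Ω → κ → ℂ}
    (hX : AEMeasurable X P) (hY : AEMeasurable Y P)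
    (h : ∀ a b, ∫ ω, Complex.exp ((a ⬝ᵥ X ω + b ⬝ᵥ Y ω).re * Complex.I) ∂P =
      (∫ ω, Complex.exp ((a ⬝ᵥ X ω).re * Complex.I) ∂P) *
        ∫ ω, Complex.exp ((b ⬝ᵥ Y ω).re * Complex.I) ∂P) : IndepFun X Y P := by
  rw [indepFun_iff_charFunDual_prod hX hY]
  intro L
  obtain ⟨a, ha⟩ := exists_dual_eq_re_dotProduct (L.comp (.inl ℝ _ _))
  obtain ⟨b, hb⟩ := exists_dual_eq_re_dotProduct (L.comp (.inr ℝ _ _))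
  have hab : ∀ x y, L (x, y) = (a ⬝ᵥ x + b ⬝ᵥ y).re := fun x y => by
    rw [Complex.add_re, ← ha, ← hb, ← L.comp_inl_add_comp_inr]
  simp only [charFunDual_apply]
  rw [integral_map (hX.prodMk hY) (by fun_prop), integral_map hX (by fun_prop),
    integral_map hY (by fun_prop)]
  simp only [ha, hb, hab]
  exact h a b

/-- The law of a vector of independent `𝒞𝒩(0, v)` entries. -/
noncomputable def gaussianVector (ι : Type*) [Fintype ι] (v : ℝ≥0) : Measure (ι → ℂ) :=
  Measure.pi fun _ => complexGaussian v

instance (v : ℝ≥0) : IsProbabilityMeasure (gaussianVector ι v) := by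
  unfold gaussianVector; infer_instance

lemma integral_cexp_gaussianVector (v : ℝ≥0) (a : ι → ℂ) :
    ∫ x, Complex.exp ((a ⬝ᵥ x).re * Complex.I) ∂gaussianVector ι v =
      Complex.exp (-(v / 4 * sqNorm a)) := by
  have h : ∀ x : ι → ℂ, Complex.exp ((a ⬝ᵥ x).re * Complex.I) =
      ∏ i, Complex.exp ((a i * x i).re * Complex.I) := fun x => by
    rw [← Complex.exp_sum, dotProduct, Complex.re_sum, Complex.ofReal_sum, Finset.sum_mul]
  simp only [h]
  rw [gaussianVector,
    integral_fintype_prod_eq_prod (fun i z => Complex.exp ((a i * z).re * Complex.I))]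
  simp only [integral_cexp_complexGaussian]
  rw [← Complex.exp_sum, sqNorm, Complex.ofReal_sum, Finset.mul_sum, Finset.sum_neg_distrib]

lemma measurable_mulVec {m n : Type*} [Fintype n] (A : Matrix m n ℂ) :
    Measurable fun x : n → ℂ => A *ᵥ x := by
  refine measurable_pi_lambda _ fun i => ?_
  simp only [mulVec, dotProduct]
  fun_prop

/-- The characteristic function depends on its argument only through the norm, and `U` acts on that
argument by the unitary matrix `Uᵀ`. -/
lemma gaussianVector_map_unitary (v : ℝ≥0) {U : Matrix ι ι ℂ} (hU : U ∈ unitaryGroup ι ℂ) :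
    (gaussianVector ι v).map (U *ᵥ ·) = gaussianVector ι v := by
  have := Measure.isProbabilityMeasure_map (μ := gaussianVector ι v)
    (measurable_mulVec U).aemeasurable
  refine measure_ext_of_integral_cexp_re fun a => ?_
  rw [integral_map (measurable_mulVec U).aemeasurable]
  · simp only [dotProduct_mulVec]
    rw [integral_cexp_gaussianVector, integral_cexp_gaussianVector]
    have hU' : Uᵀ ∈ unitaryGroup ι ℂ := by
      rw [mem_unitaryGroup_iff, star_eq_conjTranspose]
      have := congrArg Matrix.transpose (mem_unitaryGroup_iff'.1 hU)
      rw [transpose_mul, transpose_one] at this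
      exact this
    rw [← mulVec_transpose, sqNorm_unitary_mulVec hU']
  · exact (by fun_prop : Measurable _).aestronglyMeasurable

lemma exp_mul_sum_eq_prod (S : Finset ι) (u : ℝ) (f : ι → ℝ) :
    Real.exp (u * ∑ i ∈ S, f i) = ∏ i, if i ∈ S then Real.exp (u * f i) else 1 := by
  rw [Finset.mul_sum, Real.exp_sum, Finset.prod_ite_mem, Finset.univ_inter]

lemma integrable_exp_sum_gaussianVector {v : ℝ≥0} (hv : v ≠ 0) {u : ℝ} (h : u * v < 1)
    (m : ι → ℂ) (S : Finset ι) :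
    Integrable (fun x => Real.exp (u * ∑ i ∈ S, Complex.normSq (m i + x i)))
      (gaussianVector ι v) := by
  simp only [exp_mul_sum_eq_prod]
  refine Integrable.fintype_prod
    (f := fun i z => if i ∈ S then Real.exp (u * Complex.normSq (m i + z)) else 1) fun i => ?_
  by_cases hi : i ∈ S
  · simpa only [hi, if_true] using integrable_exp_mul_normSq_complexGaussian hv h (m i)
  · simp [hi]

lemma integral_exp_sum_gaussianVector {v : ℝ≥0} (hv : v ≠ 0) {u : ℝ} (h : u * v < 1)
    (m : ι → ℂ) (S : Finset ι) :
    ∫ x, Real.exp (u * ∑ i ∈ S, Complex.normSq (m i + x i)) ∂gaussianVector ι v =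
      (1 - u * v)⁻¹ ^ S.card * Real.exp (u / (1 - u * v) * ∑ i ∈ S, Complex.normSq (m i)) := by
  simp only [exp_mul_sum_eq_prod]
  rw [gaussianVector, integral_fintype_prod_eq_prod
    (fun i z => if i ∈ S then Real.exp (u * Complex.normSq (m i + z)) else 1),
    ← Finset.prod_const, ← Finset.univ_inter S, ← Finset.prod_ite_mem, Finset.univ_inter,
    ← Finset.prod_mul_distrib]
  refine Finset.prod_congr rfl fun i _ => ?_
  by_cases hi : i ∈ S
  · simp only [hi, if_true]
    rw [integral_exp_mul_normSq_complexGaussian hv h]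
    congr 2
    ring
  · simp [hi]

/-- A unitary change of variables preserves the law and turns `Q` into a coordinate projection onto
`N` coordinates, so the integral factorises. -/
lemma exp_hermForm_gaussianVector {v : ℝ≥0} (hv : v ≠ 0) {u : ℝ} (h : u * v < 1) (m : ι → ℂ)
    {Q : Matrix ι ι ℂ} (hQ : Q.IsHermitian) (hQ2 : Q * Q = Q) {N : ℕ} (hN : Q.trace = N) :
    Integrable (fun x => Real.exp (u * hermForm Q (m + x))) (gaussianVector ι v) ∧
    ∫ x, Real.exp (u * hermForm Q (m + x)) ∂gaussianVector ι v =
      (1 - u * v)⁻¹ ^ N * Real.exp (u / (1 - u * v) * hermForm Q m) := by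
  obtain ⟨U, hU, S, hS, hform⟩ := exists_unitary_hermForm_eq_sum hQ hQ2
  have hSN : S.card = N := by exact_mod_cast hS.trans hN
  have hm : Measurable fun x : ι → ℂ => U *ᵥ x := measurable_mulVec U
  have e : (fun x => Real.exp (u * hermForm Q (m + x))) =
      (fun y => Real.exp (u * ∑ i ∈ S, Complex.normSq ((U *ᵥ m) i + y i))) ∘ (U *ᵥ ·) := by
    funext x
    simp only [hform, mulVec_add, Function.comp, Pi.add_apply]
  have hI := integrable_exp_sum_gaussianVector hv h (U *ᵥ m) S
  rw [← gaussianVector_map_unitary v hU] at hI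
  constructor
  · rw [e]
    exact hI.comp_measurable hm
  · rw [e]
    refine (integral_map hm.aemeasurable (by rw [gaussianVector_map_unitary v hU]; exact
      (integrable_exp_sum_gaussianVector hv h (U *ᵥ m) S).1)).symm.trans ?_
    rw [gaussianVector_map_unitary v hU, integral_exp_sum_gaussianVector hv h, hform, hSN]

end GaussianVector

/-! ### Real projections of a circular Gaussian vector. -/

section CircularGaussian

variable {Ω ι : Type*} [MeasurableSpace Ω] [Fintype ι] [DecidableEq ι] {P : Measure Ω}
  {X : Ω → ι → ℂ} {m : ι → ℂ} {R : Matrix ι ι ℂ}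

namespace IsCircularGaussian

lemma memLp_two [IsProbabilityMeasure P] (h : IsCircularGaussian P X m R) (j : ι) :
    MemLp (fun ω => X ω j - m j) 2 P :=
  ((h.gaussian.map_fun (.proj j)).memLp_two).sub (memLp_const _)

/-- Rotation by `θ = π/2` multiplies the centred vector by `i`: the law is unchanged but the square
changes sign. -/
lemma integral_dotProduct_sq [IsProbabilityMeasure P] (h : IsCircularGaussian P X m R)
    (b : ι → ℂ) : ∫ ω, (b ⬝ᵥ (X ω - m)) ^ 2 ∂P = 0 := by
  have hm : AEMeasurable (fun ω => X ω - m) P := h.gaussian.aemeasurable.sub_const m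
  have hF : Measurable fun w : ι → ℂ => (b ⬝ᵥ w) ^ 2 := by fun_prop
  have hc := h.circular (Real.pi / 2)
  have hI : Complex.exp (((Real.pi / 2 : ℝ) : ℂ) * Complex.I) = Complex.I := by
    push_cast
    exact Complex.exp_pi_div_two_mul_I
  rw [hI] at hc
  have h1 : ∫ w, (b ⬝ᵥ w) ^ 2 ∂P.map (fun ω j => Complex.I * (X ω j - m j)) =
      -∫ ω, (b ⬝ᵥ (X ω - m)) ^ 2 ∂P := by
    refine (integral_map (φ := fun ω j => Complex.I * (X ω j - m j))
      (hm.const_smul Complex.I) hF.aestronglyMeasurable).trans ?_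
    rw [← integral_neg]
    refine integral_congr_ae (Filter.Eventually.of_forall fun ω => ?_)
    change (b ⬝ᵥ (Complex.I • (X ω - m))) ^ 2 = _
    rw [dotProduct_smul, smul_eq_mul, mul_pow, Complex.I_sq]
    simp
  have h2 : ∫ w, (b ⬝ᵥ w) ^ 2 ∂P.map (fun ω j => X ω j - m j) =
      ∫ ω, (b ⬝ᵥ (X ω - m)) ^ 2 ∂P := integral_map hm hF.aestronglyMeasurable
  rw [hc, h2] at h1
  exact self_eq_neg.1 h1

lemma integral_dotProduct_mul_star [IsProbabilityMeasure P] (h : IsCircularGaussian P X m R)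
    (b : ι → ℂ) :
    ∫ ω, (b ⬝ᵥ (X ω - m)) * star (b ⬝ᵥ (X ω - m)) ∂P = b ⬝ᵥ R *ᵥ star b := by
  have hint : ∀ j k, Integrable (fun ω => (X ω j - m j) * star (X ω k - m k)) P := fun j k =>
    (h.memLp_two j).integrable_mul (h.memLp_two k).star
  have e : ∀ ω, (b ⬝ᵥ (X ω - m)) * star (b ⬝ᵥ (X ω - m)) =
      ∑ j, ∑ k, b j * star (b k) * ((X ω j - m j) * star (X ω k - m k)) := fun ω => by
    simp only [dotProduct, star_sum, star_mul', Finset.sum_mul_sum, Pi.sub_apply]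
    exact Finset.sum_congr rfl fun j _ => Finset.sum_congr rfl fun k _ => by ring
  simp only [e]
  rw [integral_finsetSum _ fun j _ => integrable_finsetSum _ fun k _ => (hint j k).const_mul _]
  refine Finset.sum_congr rfl fun j _ => ?_
  rw [integral_finsetSum _ fun k _ => (hint j k).const_mul _, mulVec, dotProduct, Finset.mul_sum]
  refine Finset.sum_congr rfl fun k _ => ?_
  rw [integral_const_mul, h.cov, Pi.star_apply]
  ring

lemma memLp_dotProduct [IsProbabilityMeasure P] (h : IsCircularGaussian P X m R) (b : ι → ℂ) :
    MemLp (fun ω => b ⬝ᵥ (X ω - m)) 2 P := by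
  simp only [dotProduct, Pi.sub_apply]
  exact memLp_finsetSum _ fun j _ => (h.memLp_two j).const_mul _

/-- From (Re z)² = Re(z z̄ + z²)/2, where the z² term integrates to zero by circularity. -/
lemma integral_re_dotProduct_sq [IsProbabilityMeasure P] (h : IsCircularGaussian P X m R)
    (b : ι → ℂ) : ∫ ω, (b ⬝ᵥ (X ω - m)).re ^ 2 ∂P = (b ⬝ᵥ R *ᵥ star b).re / 2 := by
  have hL := h.memLp_dotProduct b
  have i1 : Integrable (fun ω => (b ⬝ᵥ (X ω - m)) * star (b ⬝ᵥ (X ω - m))) P :=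
    hL.integrable_mul hL.star
  have i2 : Integrable (fun ω => (b ⬝ᵥ (X ω - m)) ^ 2) P := by
    simp only [sq]
    exact hL.integrable_mul hL
  have e : ∀ ω, (b ⬝ᵥ (X ω - m)).re ^ 2 =
      ((b ⬝ᵥ (X ω - m)) * star (b ⬝ᵥ (X ω - m)) + (b ⬝ᵥ (X ω - m)) ^ 2).re / 2 := fun ω => by
    simp [sq]
    ring
  simp only [e]
  rw [integral_div]
  congr 1
  refine (integral_re (i1.add i2)).trans ?_
  simp only [Pi.add_apply]
  rw [integral_add i1 i2, h.integral_dotProduct_mul_star, h.integral_dotProduct_sq, add_zero]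
  rfl

lemma map_re_dotProduct [IsProbabilityMeasure P] (h : IsCircularGaussian P X m R) (b : ι → ℂ) :
    P.map (fun ω => (b ⬝ᵥ (X ω - m)).re) =
      gaussianReal 0 ((b ⬝ᵥ R *ᵥ star b).re / 2).toNNReal := by
  have hL := h.memLp_dotProduct b
  let L : (ι → ℂ) →L[ℝ] ℝ := Complex.reCLM.comp (∑ j, (b j) • (.proj j : (ι → ℂ) →L[ℝ] ℂ))
  have hLx : ∀ x, L x = (b ⬝ᵥ x).re := fun x => by simp [L, dotProduct]
  have hg : HasGaussianLaw (fun ω => (b ⬝ᵥ (X ω - m)).re) P := by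
    have h1 : IsGaussian ((P.map X).map fun x => x - m) := by
      have := h.gaussian.isGaussian_map
      infer_instance
    rw [AEMeasurable.map_map_of_aemeasurable (by fun_prop) h.gaussian.aemeasurable] at h1
    have h2 : HasGaussianLaw (fun ω => X ω - m) P := ⟨h1⟩
    simpa only [hLx] using h2.map_fun L
  have hmean : ∫ ω, (b ⬝ᵥ (X ω - m)).re ∂P = 0 := by
    refine (integral_re (hL.integrable (by norm_num))).trans ?_
    have hj : ∀ j, Integrable (fun ω => X ω j - m j) P := fun j =>
      (h.memLp_two j).integrable (by norm_num)
    have hXj : ∀ j, Integrable (fun ω => X ω j) P := fun j =>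
      ((hj j).add (integrable_const (m j))).congr
        (Filter.Eventually.of_forall fun ω => sub_add_cancel _ _)
    simp only [dotProduct, Pi.sub_apply]
    rw [integral_finsetSum _ fun j _ => (hj j).const_mul _]
    simp [integral_const_mul, integral_sub (hXj _) (integrable_const _), h.mean]
  rw [hg.map_eq_gaussianReal, hmean, variance_of_integral_eq_zero hg.aemeasurable hmean,
    h.integral_re_dotProduct_sq]

end IsCircularGaussian

end CircularGaussian

/-! ### Laws of the rows, and invertibility of the Gram matrix. -/

section Channel

variable {Ω : Type*} [MeasurableSpace Ω] {P : Measure Ω} [IsProbabilityMeasure P] {NR NT : ℕ}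
  {H : Ω → Matrix (Fin NR) (Fin NT) ℂ} {Hd : Matrix (Fin NR) (Fin NT) ℂ}
  {R : Matrix (Fin NT) (Fin NT) ℂ}

namespace IsGaussianChannel

lemma aemeasurable_entry (hH : IsGaussianChannel P H Hd R) (i : Fin NR) (j : Fin NT) :
    AEMeasurable (fun ω => H ω i j) P := by
  have h1 := (aemeasurable_pi_iff.1 (hH.row i).gaussian.aemeasurable) j
  simpa [Function.comp_def] using continuous_star.measurable.comp_aemeasurable h1

lemma aemeasurable_row (hH : IsGaussianChannel P H Hd R) (i : Fin NR) :
    AEMeasurable (fun ω j => H ω i j) P :=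
  aemeasurable_pi_lambda _ fun j => hH.aemeasurable_entry i j

/-- The covariance is prescribed for the conjugated rows; conjugation leaves real parts unchanged
and moves the star onto `a`. -/
lemma map_re_row (hH : IsGaussianChannel P H Hd R) (i : Fin NR) (a : Fin NT → ℂ) :
    P.map (fun ω => (a ⬝ᵥ (H ω - Hd) i).re) =
      gaussianReal 0 ((star a ⬝ᵥ R *ᵥ a).re / 2).toNNReal := by
  have h1 := (hH.row i).map_re_dotProduct (star a)
  rw [star_star] at h1
  rw [← h1]
  congr 1
  funext ω
  rw [← Complex.conj_re]
  congr 1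
  simp [dotProduct, Matrix.sub_apply]

lemma integral_cexp_row (hR : R.PosSemidef) (hH : IsGaussianChannel P H Hd R) (i : Fin NR)
    (a : Fin NT → ℂ) :
    ∫ ω, Complex.exp ((a ⬝ᵥ (H ω - Hd) i).re * Complex.I) ∂P =
      Complex.exp (-((star a ⬝ᵥ R *ᵥ a).re / 4 : ℝ)) := by
  have hm : AEMeasurable (fun ω => (a ⬝ᵥ (H ω - Hd) i).re) P := by
    refine AEMeasurable.of_map_ne_zero ?_
    rw [hH.map_re_row]
    exact IsProbabilityMeasure.ne_zero _
  have h1 : ∫ ω, Complex.exp ((a ⬝ᵥ (H ω - Hd) i).re * Complex.I) ∂P =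
      charFun (P.map (fun ω => (a ⬝ᵥ (H ω - Hd) i).re)) 1 := by
    rw [charFun_apply_real, integral_map hm (by fun_prop)]
    simp
  have h0 : 0 ≤ (star a ⬝ᵥ R *ᵥ a).re := (Complex.nonneg_iff.1 (hR.dotProduct_mulVec_nonneg a)).1
  rw [h1, hH.map_re_row, charFun_gaussianReal, Real.coe_toNNReal _ (by positivity)]
  congr 1
  push_cast
  ring

lemma ae_isUnit_det (hNT : NT ≤ NR) (hR : R.PosDef) (hH : IsGaussianChannel P H Hd R) :
    ∀ᵐ ω ∂P, IsUnit ((H ω)ᴴ * H ω).det := by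
  have hind : iIndepFun (fun (i : Fin NT) (ω : Ω) (j : Fin NT) => H ω (Fin.castLE hNT i) j) P :=
    hH.indep.precomp (Fin.castLE_injective hNT)
  have hmeas := fun i : Fin NT => hH.aemeasurable_row (Fin.castLE hNT i)
  have hmap := (iIndepFun_iff_map_fun_eq_pi_map hmeas).1 hind
  have : ∀ i : Fin NT, IsProbabilityMeasure (P.map fun ω j => H ω (Fin.castLE hNT i) j) :=
    fun i => Measure.isProbabilityMeasure_map (hmeas i)
  have key := ae_linearIndependent_pi le_rfl
    (fun i : Fin NT => P.map fun ω j => H ω (Fin.castLE hNT i) j) ?_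
  · rw [← hmap] at key
    filter_upwards [ae_of_ae_map (aemeasurable_pi_lambda _ hmeas) key] with ω hω
    exact isUnit_det_gram_of_rows hNT _ hω
  · intro i v hv
    have hpos : 0 < (star v ⬝ᵥ R *ᵥ v).re := (Complex.pos_iff.1 (hR.dotProduct_mulVec_pos hv)).1
    change (P.map fun ω j => H ω (Fin.castLE hNT i) j) ((fun x => v ⬝ᵥ x) ⁻¹' {0}) = 0
    rw [Measure.map_apply_of_aemeasurable (hmeas i)
      ((measurableSet_singleton (0 : ℂ)).preimage (measurable_dotProduct v))]
    have hm := hH.map_re_row (Fin.castLE hNT i) v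
    have hv0 : ((star v ⬝ᵥ R *ᵥ v).re / 2).toNNReal ≠ 0 := by
      rw [Ne, Real.toNNReal_eq_zero]
      linarith
    have hm' : AEMeasurable (fun ω => (v ⬝ᵥ (H ω - Hd) (Fin.castLE hNT i)).re) P := by
      refine AEMeasurable.of_map_ne_zero ?_
      rw [hm]
      exact IsProbabilityMeasure.ne_zero _
    -- The hyperplane event pins the real part of a linear form to one value, and that real part is
    -- a nondegenerate Gaussian because `R` is definite.
    have hatom : P.map (fun ω => (v ⬝ᵥ (H ω - Hd) (Fin.castLE hNT i)).re)
        {-(v ⬝ᵥ Hd (Fin.castLE hNT i)).re} = 0 := by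
      rw [hm]
      have := nullSingletonClass_gaussianReal (μ := 0) hv0
      exact measure_singleton _
    rw [Measure.map_apply_of_aemeasurable hm' (measurableSet_singleton _)] at hatom
    refine measure_mono_null (fun ω hω => ?_) hatom
    simp only [Set.mem_preimage, Set.mem_singleton_iff] at hω ⊢
    have : v ⬝ᵥ (H ω - Hd) (Fin.castLE hNT i) = v ⬝ᵥ (fun j => H ω (Fin.castLE hNT i) j) -
      v ⬝ᵥ Hd (Fin.castLE hNT i) := by
      rw [← dotProduct_sub]; rfl
    rw [this, show (v ⬝ᵥ fun j => H ω (Fin.castLE hNT i) j) = 0 from hω]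
    simp

end IsGaussianChannel

end Channel

/-! ### Joint law of the innovation and the interference. -/

section ChannelLaw

variable {Ω : Type*} [MeasurableSpace Ω] {P : Measure Ω} [IsProbabilityMeasure P] {NR NT : ℕ}
  {H : Ω → Matrix (Fin NR) (Fin NT) ℂ} {Hd : Matrix (Fin NR) (Fin NT) ℂ}
  {R : Matrix (Fin NT) (Fin NT) ℂ}

/-- The quadratic form in the exponent of the characteristic function of a channel. -/
noncomputable def channelForm (R : Matrix (Fin NT) (Fin NT) ℂ) (A : Matrix (Fin NR) (Fin NT) ℂ) :
    ℝ := ∑ i, (star (A i) ⬝ᵥ R *ᵥ A i).re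

lemma channelForm_eq_trace (A : Matrix (Fin NR) (Fin NT) ℂ) :
    channelForm R A = (Aᴴᵀ * R * Aᵀ).trace.re := by
  rw [channelForm, trace, Complex.re_sum]
  refine Finset.sum_congr rfl fun i _ => ?_
  rw [diag_apply, Matrix.mul_assoc, Matrix.mul_apply]
  rfl

/-- Written as a trace, the form loses the unitary factor by cyclicity: there is no receive
correlation. -/
lemma channelForm_unitary {U : Matrix (Fin NR) (Fin NR) ℂ} (hU : U ∈ unitaryGroup (Fin NR) ℂ)
    (A : Matrix (Fin NR) (Fin NT) ℂ) : channelForm R (Uᵀ * A) = channelForm R A := by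
  have h1 : U * Uᴴ = 1 := mem_unitaryGroup_iff.1 hU
  have h2 : (Uᵀ * A)ᴴᵀ * R * (Uᵀ * A)ᵀ = Uᴴ * (Aᴴᵀ * R * Aᵀ * U) := by
    rw [conjTranspose_mul, transpose_mul, transpose_mul, transpose_transpose]
    have : Uᵀᴴᵀ = Uᴴ := by ext; simp
    rw [this]
    simp only [Matrix.mul_assoc]
  rw [channelForm_eq_trace, channelForm_eq_trace, h2, trace_mul_comm, Matrix.mul_assoc _ U, h1,
    Matrix.mul_one]

/-- The hypothesis says that the two linear statistics are uncorrelated, so the cross terms of the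
quadratic form vanish. -/
lemma channelForm_add (hR : R.IsHermitian) (A B : Matrix (Fin NR) (Fin NT) ℂ)
    (h : ∀ i, star (B i) ⬝ᵥ R *ᵥ A i = 0) :
    channelForm R (A + B) = channelForm R A + channelForm R B := by
  rw [channelForm, channelForm, channelForm, ← Finset.sum_add_distrib]
  refine Finset.sum_congr rfl fun i _ => ?_
  have h' : star (A i) ⬝ᵥ R *ᵥ B i = 0 := by
    have := congrArg star (h i)
    rwa [star_dotProduct, star_star, star_zero, star_mulVec, hR.eq, ← dotProduct_mulVec] at this
  have e : (A + B) i = A i + B i := rfl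
  rw [e, star_add, mulVec_add, dotProduct_add, add_dotProduct, add_dotProduct, h i, h']
  simp

lemma IsGaussianChannel.integral_cexp (hR : R.PosSemidef) (hH : IsGaussianChannel P H Hd R)
    (A : Matrix (Fin NR) (Fin NT) ℂ) :
    ∫ ω, Complex.exp ((∑ i, A i ⬝ᵥ (H ω - Hd) i).re * Complex.I) ∂P =
      Complex.exp (-(channelForm R A / 4 : ℝ)) := by
  have e : ∀ ω, Complex.exp ((∑ i, A i ⬝ᵥ (H ω - Hd) i).re * Complex.I) =
      ∏ i, Complex.exp ((A i ⬝ᵥ ((fun j => H ω i j) - Hd i)).re * Complex.I) := fun ω => by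
    rw [← Complex.exp_sum, Complex.re_sum, Complex.ofReal_sum, Finset.sum_mul]
    rfl
  simp only [e]
  rw [hH.indep.integral_fun_prod_comp
    (f := fun i x => Complex.exp ((A i ⬝ᵥ (x - Hd i)).re * Complex.I)) hH.aemeasurable_row
    (fun i => (by fun_prop : Measurable fun x : Fin NT → ℂ =>
      Complex.exp ((A i ⬝ᵥ (x - Hd i)).re * Complex.I)).aestronglyMeasurable)]
  refine (Finset.prod_congr rfl fun i _ => hH.integral_cexp_row hR i (A i)).trans ?_
  rw [← Complex.exp_sum, channelForm]
  push_cast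
  rw [Finset.sum_neg_distrib, Finset.sum_div]

/-- The matrix with the given family of entries. -/
def unflatten {m n : Type*} (k : m × n → ℂ) : Matrix m n ℂ := Matrix.of fun i j => k (i, j)

variable [NeZero NT]

/-- The entries of a channel matrix whose first column is replaced by zero. -/
def interference (A : Matrix (Fin NR) (Fin NT) ℂ) : Fin NR × Fin NT → ℂ :=
  fun p => if p.2 = 0 then 0 else A p.1 p.2

/-- Zeroing the first-column coefficients makes the test vector see only interfering columns; their
mean is zero, so centring changes nothing. -/
lemma dotProduct_interference (hHd : ∀ i, ∀ j ≠ 0, Hd i j = 0) (b : Fin NR × Fin NT → ℂ)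
    (A : Matrix (Fin NR) (Fin NT) ℂ) :
    b ⬝ᵥ interference A = ∑ i, unflatten (interference (unflatten b)) i ⬝ᵥ (A - Hd) i := by
  rw [dotProduct, Fintype.sum_prod_type]
  refine Finset.sum_congr rfl fun i _ => Finset.sum_congr rfl fun j _ => ?_
  change b (i, j) * (if j = 0 then 0 else A i j) =
    (if j = 0 then 0 else b (i, j)) * (A i j - Hd i j)
  by_cases hj : j = 0
  · simp [hj]
  · simp [hj, hHd i j hj]

lemma dotProduct_mulVec_eq_sum (a : Fin NR → ℂ) (w : Fin NT → ℂ)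
    (A : Matrix (Fin NR) (Fin NT) ℂ) :
    a ⬝ᵥ (A *ᵥ w) = ∑ i, vecMulVec a w i ⬝ᵥ A i := by
  refine Finset.sum_congr rfl fun i _ => ?_
  rw [mulVec, dotProduct, dotProduct, Finset.mul_sum]
  refine Finset.sum_congr rfl fun j _ => ?_
  rw [vecMulVec_apply]
  ring

lemma channelForm_vecMulVec {w : Fin NT → ℂ} {c : ℝ≥0} (hw : R *ᵥ w = Pi.single 0 ((c : ℝ) : ℂ))
    (hw0 : w 0 = 1) (a : Fin NR → ℂ) : channelForm R (vecMulVec a w) = c * sqNorm a := by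
  rw [channelForm, sqNorm, Finset.mul_sum]
  refine Finset.sum_congr rfl fun i _ => ?_
  have e : vecMulVec a w i = a i • w := by ext j; simp [vecMulVec_apply]
  rw [e, mulVec_smul, hw, star_smul, smul_dotProduct, dotProduct_smul, dotProduct_single,
    Pi.star_apply, hw0, Complex.normSq_apply]
  simp
  ring

namespace IsGaussianChannel

lemma aemeasurable_innovation (hH : IsGaussianChannel P H Hd R) (w : Fin NT → ℂ) :
    AEMeasurable (fun ω => (H ω - Hd) *ᵥ w) P := by
  refine aemeasurable_pi_lambda _ fun i => ?_
  simp only [mulVec, dotProduct, Matrix.sub_apply]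
  exact Finset.aemeasurable_fun_sum _ fun j _ =>
    ((hH.aemeasurable_entry i j).sub_const _).mul_const _

lemma aemeasurable_interference (hH : IsGaussianChannel P H Hd R) :
    AEMeasurable (fun ω => interference (H ω)) P := by
  refine aemeasurable_pi_lambda _ fun p => ?_
  by_cases hp : p.2 = 0
  · simp [interference, hp]
  · simpa [interference, hp] using hH.aemeasurable_entry p.1 p.2

lemma integral_cexp_interference (hR : R.PosSemidef) (hH : IsGaussianChannel P H Hd R)
    (hHd : ∀ i, ∀ j ≠ 0, Hd i j = 0) (b : Fin NR × Fin NT → ℂ) :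
    ∫ ω, Complex.exp ((b ⬝ᵥ interference (H ω)).re * Complex.I) ∂P =
      Complex.exp (-(channelForm R (unflatten (interference (unflatten b))) / 4 : ℝ)) := by
  simp only [dotProduct_interference hHd]
  exact hH.integral_cexp hR _

lemma integral_cexp_innovation (hR : R.PosSemidef) (hH : IsGaussianChannel P H Hd R)
    {w : Fin NT → ℂ} {c : ℝ≥0} (hw : R *ᵥ w = Pi.single 0 ((c : ℝ) : ℂ)) (hw0 : w 0 = 1)
    (a : Fin NR → ℂ) :
    ∫ ω, Complex.exp ((a ⬝ᵥ ((H ω - Hd) *ᵥ w)).re * Complex.I) ∂P =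
      Complex.exp (-(c * sqNorm a / 4 : ℝ)) := by
  simp only [dotProduct_mulVec_eq_sum]
  rw [hH.integral_cexp hR, channelForm_vecMulVec hw hw0]

/-- The part of the intended stream that is uncorrelated with the interference is independent
of it. -/
lemma indepFun_innovation_interference (hR : R.PosSemidef) (hH : IsGaussianChannel P H Hd R)
    (hHd : ∀ i, ∀ j ≠ 0, Hd i j = 0) {w : Fin NT → ℂ} {c : ℝ≥0}
    (hw : R *ᵥ w = Pi.single 0 ((c : ℝ) : ℂ)) (hw0 : w 0 = 1) :
    IndepFun (fun ω => (H ω - Hd) *ᵥ w) (fun ω => interference (H ω)) P := by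
  refine indepFun_of_integral_cexp_re (hH.aemeasurable_innovation w)
    hH.aemeasurable_interference fun a b => ?_
  rw [hH.integral_cexp_interference hR hHd, hH.integral_cexp_innovation hR hw hw0,
    ← channelForm_vecMulVec hw hw0, ← Complex.exp_add]
  have e : ∀ ω, a ⬝ᵥ ((H ω - Hd) *ᵥ w) + b ⬝ᵥ interference (H ω) =
      ∑ i, (vecMulVec a w + unflatten (interference (unflatten b))) i ⬝ᵥ (H ω - Hd) i := fun ω => by
    rw [dotProduct_mulVec_eq_sum, dotProduct_interference hHd, ← Finset.sum_add_distrib]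
    refine Finset.sum_congr rfl fun i _ => ?_
    rw [← add_dotProduct]
    rfl
  simp only [e]
  rw [hH.integral_cexp hR, channelForm_add hR.isHermitian]
  · congr 1
    push_cast
    ring
  · intro i
    have e : vecMulVec a w i = a i • w := by ext j; simp [vecMulVec_apply]
    -- `R *ᵥ w` is supported on the first coordinate, exactly where the interference coefficients
    -- are zero.
    rw [e, mulVec_smul, hw, dotProduct_smul, dotProduct_single]
    simp [unflatten, interference]

lemma map_innovation (hR : R.PosSemidef) (hH : IsGaussianChannel P H Hd R)
    {w : Fin NT → ℂ} {c : ℝ≥0} (hw : R *ᵥ w = Pi.single 0 ((c : ℝ) : ℂ)) (hw0 : w 0 = 1) :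
    P.map (fun ω => (H ω - Hd) *ᵥ w) = gaussianVector (Fin NR) c := by
  have := Measure.isProbabilityMeasure_map (hH.aemeasurable_innovation w)
  refine measure_ext_of_integral_cexp_re fun a => ?_
  rw [integral_map (hH.aemeasurable_innovation w) (by fun_prop), integral_cexp_gaussianVector,
    hH.integral_cexp_innovation hR hw hw0]
  congr 1
  push_cast
  ring

/-- Source of isotropy: `U` passes to the test coefficients as `Uᵀ`, which leaves `channelForm`
unchanged. -/
lemma map_interference_unitary (hR : R.PosSemidef) (hH : IsGaussianChannel P H Hd R)
    (hHd : ∀ i, ∀ j ≠ 0, Hd i j = 0) {U : Matrix (Fin NR) (Fin NR) ℂ}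
    (hU : U ∈ unitaryGroup (Fin NR) ℂ) :
    P.map (fun ω => interference (U * H ω)) = P.map (fun ω => interference (H ω)) := by
  have hm : AEMeasurable (fun ω => interference (U * H ω)) P := by
    refine aemeasurable_pi_lambda _ fun p => ?_
    by_cases hp : p.2 = 0
    · simp [interference, hp]
    · simp only [interference, hp, if_false, Matrix.mul_apply]
      exact Finset.aemeasurable_fun_sum _ fun j _ => (hH.aemeasurable_entry j p.2).const_mul _
  have := Measure.isProbabilityMeasure_map hm
  have := Measure.isProbabilityMeasure_map hH.aemeasurable_interference
  refine measure_ext_of_integral_cexp_re fun b => ?_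
  rw [integral_map hm (by fun_prop), integral_map hH.aemeasurable_interference (by fun_prop)]
  have e : ∀ ω, b ⬝ᵥ interference (U * H ω) =
      (fun p : Fin NR × Fin NT => (Uᵀ * unflatten b) p.1 p.2) ⬝ᵥ interference (H ω) := fun ω => by
    simp only [dotProduct, Fintype.sum_prod_type_right, interference]
    refine Finset.sum_congr rfl fun j _ => ?_
    by_cases hj : j = 0
    · simp [hj]
    · simp only [hj, if_false, Matrix.mul_apply, Finset.mul_sum, Finset.sum_mul]
      rw [Finset.sum_comm]
      refine Finset.sum_congr rfl fun i _ => Finset.sum_congr rfl fun l _ => ?_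
      simp only [transpose_apply, unflatten, of_apply]
      ring
  simp only [e]
  rw [hH.integral_cexp_interference hR hHd, hH.integral_cexp_interference hR hHd,
    ← channelForm_unitary hU (unflatten (interference (unflatten b)))]
  congr 5
  ext i j
  by_cases hj : j = 0
  · simp [unflatten, interference, hj, Matrix.mul_apply]
  · simp [unflatten, interference, hj, Matrix.mul_apply]

end IsGaussianChannel

end ChannelLaw

/-! ### Gamma moments and averaging over an isotropic projection. -/

section Moments

/-- At `u = 0` these are the Gamma moments, since (1 - u)⁻ᴺ is the moment-generating function of
`hermForm Q` for a projection of trace `N`. -/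
lemma iteratedDeriv_inv_one_sub_pow (N n : ℕ) {u : ℝ} (hu : u < 1) :
    iteratedDeriv n (fun u : ℝ => (1 - u)⁻¹ ^ N) u =
      (ascPochhammer ℝ n).eval (N : ℝ) * (1 - u)⁻¹ ^ (N + n) := by
  induction n generalizing u with
  | zero => simp
  | succ n ih =>
    have h0 : 1 - u ≠ 0 := by linarith
    have heq : iteratedDeriv n (fun u : ℝ => (1 - u)⁻¹ ^ N) =ᶠ[nhds u]
        fun u => (ascPochhammer ℝ n).eval (N : ℝ) * (1 - u)⁻¹ ^ (N + n) := by
      filter_upwards [Iio_mem_nhds hu] with y hy using ih hy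
    have hd : HasDerivAt (fun u : ℝ => (1 - u)⁻¹ ^ (N + n))
        ((N + n : ℕ) * (1 - u)⁻¹ ^ (N + n + 1)) u := by
      have h1 : HasDerivAt (fun u : ℝ => (1 - u)⁻¹) ((1 - u)⁻¹ ^ 2) u := by
        refine (((hasDerivAt_id u).const_sub 1).fun_inv h0).congr_deriv ?_
        simp [div_eq_mul_inv]
      refine (h1.fun_pow (N + n)).congr_deriv ?_
      rcases Nat.eq_zero_or_pos (N + n) with h | h
      · simp [h]
      · rw [mul_assoc, ← pow_add]
        congr 2
        omega
    rw [iteratedDeriv_succ, heq.deriv_eq, (hd.const_mul _).deriv, ascPochhammer_succ_eval]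
    push_cast
    ring

variable {ι : Type*} [Fintype ι] [DecidableEq ι]

lemma zero_mem_interior_integrableExpSet_hermForm {Q : Matrix ι ι ℂ} (hQ : Q.IsHermitian)
    (hQ2 : Q * Q = Q) {N : ℕ} (hN : Q.trace = N) :
    0 ∈ interior (integrableExpSet (hermForm Q) (gaussianVector ι 1)) := by
  rw [mem_interior_iff_mem_nhds]
  filter_upwards [Iio_mem_nhds (zero_lt_one (α := ℝ))] with u hu
  have := (exp_hermForm_gaussianVector one_ne_zero (by simpa using hu) 0 hQ hQ2 hN).1
  simpa [integrableExpSet] using this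

lemma integrable_hermForm_pow {Q : Matrix ι ι ℂ} (hQ : Q.IsHermitian) (hQ2 : Q * Q = Q)
    {N : ℕ} (hN : Q.trace = N) (n : ℕ) :
    Integrable (fun x => hermForm Q x ^ n) (gaussianVector ι 1) :=
  integrable_pow_of_mem_interior_integrableExpSet
    (zero_mem_interior_integrableExpSet_hermForm hQ hQ2 hN) n

/-- The moments of the Gamma law with shape parameter `N`. -/
lemma integral_hermForm_pow {Q : Matrix ι ι ℂ} (hQ : Q.IsHermitian) (hQ2 : Q * Q = Q)
    {N : ℕ} (hN : Q.trace = N) (n : ℕ) :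
    ∫ x, hermForm Q x ^ n ∂gaussianVector ι 1 = (ascPochhammer ℝ n).eval (N : ℝ) := by
  have h1 := iteratedDeriv_mgf_zero (zero_mem_interior_integrableExpSet_hermForm hQ hQ2 hN) n
  have heq : mgf (hermForm Q) (gaussianVector ι 1) =ᶠ[nhds 0] fun u => (1 - u)⁻¹ ^ N := by
    filter_upwards [Iio_mem_nhds (zero_lt_one (α := ℝ))] with u hu
    have := (exp_hermForm_gaussianVector one_ne_zero (by simpa using hu) 0 hQ hQ2 hN).2
    simpa [mgf, hermForm] using this
  rw [heq.iteratedDeriv_eq, iteratedDeriv_inv_one_sub_pow N n zero_lt_one] at h1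
  simpa using h1.symm

variable {𝒦 : Type*} [MeasurableSpace 𝒦] {ν : Measure 𝒦} [IsProbabilityMeasure ν]
  {Q : 𝒦 → Matrix ι ι ℂ}

@[fun_prop]
lemma measurable_hermForm_comp {α : Type*} [MeasurableSpace α] {Q : α → Matrix ι ι ℂ}
    {x : α → ι → ℂ} (hQ : ∀ i j, Measurable fun a => Q a i j) (hx : Measurable x) :
    Measurable fun a => hermForm (Q a) (x a) := by
  unfold hermForm
  simp only [dotProduct, mulVec, Pi.star_apply]
  fun_prop

/-- The moments of the squared norm of a fixed vector projected on an isotropic random subspace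
are those of a Beta law. -/
lemma integral_hermForm_pow_of_isotropic [Nonempty ι] (hm : ∀ i j, Measurable fun k => Q k i j)
    (hQ : ∀ k, (Q k).IsHermitian) (hQ2 : ∀ k, Q k * Q k = Q k) {N : ℕ}
    (hN : ∀ᵐ k ∂ν, (Q k).trace = N)
    (hU : ∀ U ∈ unitaryGroup ι ℂ, ∀ (x : ι → ℂ) (n : ℕ),
      ∫ k, hermForm (Q k) (U *ᵥ x) ^ n ∂ν = ∫ k, hermForm (Q k) x ^ n ∂ν)
    (n : ℕ) (x : ι → ℂ) :
    ∫ k, hermForm (Q k) x ^ n ∂ν = (ascPochhammer ℝ n).eval (N : ℝ) /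
      (ascPochhammer ℝ n).eval (Fintype.card ι : ℝ) * sqNorm x ^ n := by
  obtain ⟨i₀⟩ := ‹Nonempty ι›
  -- By isotropy every direction has the moment of this reference direction, up to the scale `sqNorm
  -- x ^ n`.
  set c := ∫ k, hermForm (Q k) (Pi.single i₀ 1) ^ n ∂ν with hc
  have hx : ∀ x, ∫ k, hermForm (Q k) x ^ n ∂ν = sqNorm x ^ n * c := fun x => by
    obtain ⟨U, hUm, hUx⟩ := exists_unitary_mulVec_eq_single i₀ x
    rw [← hU U hUm x n, hUx]
    simp only [hermForm_smul, Real.sq_sqrt (sqNorm_nonneg x), mul_pow]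
    rw [integral_const_mul]
  have htr : (1 : Matrix ι ι ℂ).trace = (Fintype.card ι : ℕ) := trace_one
  have hsq := integrable_hermForm_pow isHermitian_one (one_mul (1 : Matrix ι ι ℂ)) htr n
  simp only [hermForm_one] at hsq
  have hint : Integrable (Function.uncurry fun x k => hermForm (Q k) x ^ n)
      ((gaussianVector ι 1).prod ν) := by
    refine (hsq.comp_fst ν).mono' ?_ (Filter.Eventually.of_forall fun p => ?_)
    · refine Measurable.aestronglyMeasurable ?_
      exact (measurable_hermForm_comp (fun i j => (hm i j).comp measurable_snd)
        measurable_fst).pow_const n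
    · simp only [Function.uncurry]
      rw [Real.norm_of_nonneg (pow_nonneg (hermForm_nonneg (hQ _) (hQ2 _) _) _)]
      exact pow_le_pow_left₀ (hermForm_nonneg (hQ _) (hQ2 _) _) (hermForm_le (hQ _) (hQ2 _) _) _
  -- Averaging over Gaussian `x` in both orders: `Q` first gives `c` times the moment of shape `card
  -- ι`, `x` first gives the moment of shape `N`.
  have hswap := integral_integral_swap hint
  simp only [hx] at hswap
  rw [integral_mul_const] at hswap
  have h1 := integral_hermForm_pow isHermitian_one (one_mul (1 : Matrix ι ι ℂ)) htr n
  simp only [hermForm_one] at h1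
  have h2 : ∫ k, ∫ x, hermForm (Q k) x ^ n ∂gaussianVector ι 1 ∂ν =
      (ascPochhammer ℝ n).eval (N : ℝ) := by
    rw [integral_congr_ae (g := fun _ => (ascPochhammer ℝ n).eval (N : ℝ))]
    · simp
    · filter_upwards [hN] with k hk using integral_hermForm_pow (hQ k) (hQ2 k) hk n
  rw [h1, h2] at hswap
  have hpos : 0 < (ascPochhammer ℝ n).eval (Fintype.card ι : ℝ) :=
    ascPochhammer_pos n _ (by exact_mod_cast Fintype.card_pos)
  rw [hx, ← hswap]
  field_simp

/-- The exponential series is integrated termwise, dominated by the series of exp(|t| ‖x‖²). -/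
lemma integral_exp_hermForm_of_isotropic [Nonempty ι] (hm : ∀ i j, Measurable fun k => Q k i j)
    (hQ : ∀ k, (Q k).IsHermitian) (hQ2 : ∀ k, Q k * Q k = Q k) {N : ℕ}
    (hN : ∀ᵐ k ∂ν, (Q k).trace = N)
    (hU : ∀ U ∈ unitaryGroup ι ℂ, ∀ (x : ι → ℂ) (n : ℕ),
      ∫ k, hermForm (Q k) (U *ᵥ x) ^ n ∂ν = ∫ k, hermForm (Q k) x ^ n ∂ν)
    (t : ℝ) (x : ι → ℂ) :
    ∫ k, Real.exp (t * hermForm (Q k) x) ∂ν =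
      kummer1F1 N (Fintype.card ι) (t * sqNorm x) := by
  have hmx : Measurable fun k => hermForm (Q k) x := measurable_hermForm_comp hm measurable_const
  have hbound : ∀ n k, ‖(t * hermForm (Q k) x) ^ n / (n.factorial : ℝ)‖ ≤
      (|t| * sqNorm x) ^ n / n.factorial := fun n k => by
    rw [norm_div, norm_pow, norm_mul, Real.norm_eq_abs, Real.norm_eq_abs,
      abs_of_nonneg (hermForm_nonneg (hQ k) (hQ2 k) x), Real.norm_of_nonneg (Nat.cast_nonneg _)]
    exact div_le_div_of_nonneg_right (pow_le_pow_left₀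
      (mul_nonneg (abs_nonneg _) (hermForm_nonneg (hQ k) (hQ2 k) x))
      (mul_le_mul_of_nonneg_left (hermForm_le (hQ k) (hQ2 k) x) (abs_nonneg _)) n)
      (Nat.cast_nonneg _)
  have hs : HasSum (fun n => ∫ k, (t * hermForm (Q k) x) ^ n / (n.factorial : ℝ) ∂ν)
      (∫ k, Real.exp (t * hermForm (Q k) x) ∂ν) := by
    refine hasSum_integral_of_dominated_convergence
      (fun n _ => (|t| * sqNorm x) ^ n / n.factorial) (fun n => ?_) (fun n => ?_) ?_ ?_ ?_
    · exact (((hmx.const_mul t).pow_const n).div_const _).aestronglyMeasurable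
    · exact Filter.Eventually.of_forall (hbound n)
    · exact Filter.Eventually.of_forall fun k => Real.summable_pow_div_factorial _
    · exact integrable_const _
    · refine Filter.Eventually.of_forall fun k => ?_
      rw [Real.exp_eq_exp_ℝ]
      exact NormedSpace.expSeries_div_hasSum_exp _
  rw [← hs.tsum_eq, kummer1F1]
  refine tsum_congr fun n => ?_
  rw [integral_div]
  simp only [mul_pow]
  rw [integral_const_mul, integral_hermForm_pow_of_isotropic hm hQ hQ2 hN hU]
  ring

/-- The moment-generating function of `(h + e)ᴴ Q (h + e)` for a complex Gaussian vector `e`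
independent of the projection `Q` on an isotropic random subspace. -/
lemma exp_hermForm_prod_of_isotropic [Nonempty ι] (hm : ∀ i j, Measurable fun k => Q k i j)
    (hQ : ∀ k, (Q k).IsHermitian) (hQ2 : ∀ k, Q k * Q k = Q k) {N : ℕ}
    (hN : ∀ᵐ k ∂ν, (Q k).trace = N)
    (hU : ∀ U ∈ unitaryGroup ι ℂ, ∀ (x : ι → ℂ) (n : ℕ),
      ∫ k, hermForm (Q k) (U *ᵥ x) ^ n ∂ν = ∫ k, hermForm (Q k) x ^ n ∂ν)
    {v : ℝ≥0} (hv : v ≠ 0) {u : ℝ} (hu : u * v < 1) (h : ι → ℂ) :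
    Integrable (fun p : (ι → ℂ) × 𝒦 => Real.exp (u * hermForm (Q p.2) (h + p.1)))
      ((gaussianVector ι v).prod ν) ∧
    ∫ p : (ι → ℂ) × 𝒦, Real.exp (u * hermForm (Q p.2) (h + p.1)) ∂(gaussianVector ι v).prod ν =
      1 / (1 - u * v) ^ N *
        kummer1F1 N (Fintype.card ι) (u / (1 - u * v) * sqNorm h) := by
  have hmeas : Measurable fun p : (ι → ℂ) × 𝒦 => Real.exp (u * hermForm (Q p.2) (h + p.1)) :=
    ((measurable_hermForm_comp (fun i j => (hm i j).comp measurable_snd)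
      (measurable_fst.const_add h)).const_mul u).exp
  have htr : (1 : Matrix ι ι ℂ).trace = (Fintype.card ι : ℕ) := trace_one
  have hint : Integrable (fun p : (ι → ℂ) × 𝒦 => Real.exp (u * hermForm (Q p.2) (h + p.1)))
      ((gaussianVector ι v).prod ν) := by
    -- The dominating function is the integrand for `Q = 1` plus the constant 1: the first covers `u
    -- ≥ 0`, the second `u ≤ 0`.
    have h1 := (exp_hermForm_gaussianVector hv hu h isHermitian_one (one_mul _) htr).1
    refine ((h1.comp_fst ν).add (integrable_const (1 : ℝ))).mono' hmeas.aestronglyMeasurable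
      (Filter.Eventually.of_forall fun p => ?_)
    rw [Real.norm_of_nonneg (Real.exp_pos _).le, Pi.add_apply, hermForm_one]
    rcases le_total 0 u with h0 | h0
    · refine le_add_of_le_of_nonneg (Real.exp_le_exp.2 ?_) zero_le_one
      exact mul_le_mul_of_nonneg_left (hermForm_le (hQ _) (hQ2 _) _) h0
    · refine le_add_of_nonneg_of_le (Real.exp_pos _).le (Real.exp_le_one_iff.2 ?_)
      exact mul_nonpos_of_nonpos_of_nonneg h0 (hermForm_nonneg (hQ _) (hQ2 _) _)
  refine ⟨hint, ?_⟩
  rw [integral_prod_symm _ hint, ← integral_exp_hermForm_of_isotropic hm hQ hQ2 hN hU,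
    ← integral_const_mul]
  refine integral_congr_ae ?_
  filter_upwards [hN] with k hk
  rw [(exp_hermForm_gaussianVector hv hu h (hQ k) (hQ2 k) hk).2, inv_pow, one_div]

end Moments

/-! ### A moment-generating function finite near zero determines the law. -/

section MGFUniqueness

/-- Real random variables whose moment-generating functions are finite and agree near zero have
the same law. -/
lemma map_eq_of_mgf_eventuallyEq {Ω Ω' : Type*} [MeasurableSpace Ω] [MeasurableSpace Ω']
    {μ : Measure Ω} {μ' : Measure Ω'} [IsProbabilityMeasure μ] [IsProbabilityMeasure μ']
    {X : Ω → ℝ} {Y : Ω' → ℝ} (hX : AEMeasurable X μ) (hY : AEMeasurable Y μ')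
    (h0 : 0 ∈ interior (integrableExpSet X μ)) (h0' : 0 ∈ interior (integrableExpSet Y μ'))
    (h : mgf X μ =ᶠ[nhds 0] mgf Y μ') : μ.map X = μ'.map Y := by
  set V := interior (integrableExpSet X μ) ∩ interior (integrableExpSet Y μ') with hV
  -- Identity theorem on a vertical strip: both functions are analytic there and agree at real
  -- points accumulating at 0. The strip contains the imaginary axis, where they are the
  -- characteristic functions.
  have heq : Set.EqOn (complexMGF X μ) (complexMGF Y μ') {z | z.re ∈ V} := by
    refine AnalyticOnNhd.eqOn_of_preconnected_of_frequently_eq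
      (analyticOnNhd_complexMGF.mono fun z hz => hz.1)
      (analyticOnNhd_complexMGF.mono fun z hz => hz.2)
      ((convex_integrableExpSet.interior.inter convex_integrableExpSet.interior).linear_preimage
        Complex.reLm).isPreconnected (z₀ := ((0 : ℝ) : ℂ))
      ⟨by simpa using h0, by simpa using h0'⟩ ?_
    have hreal : ∃ᶠ x : ℝ in nhdsWithin 0 {0}ᶜ, complexMGF X μ x = complexMGF Y μ' x := by
      refine Filter.Eventually.frequently (Filter.Eventually.filter_mono nhdsWithin_le_nhds ?_)
      filter_upwards [h] with x hx
      rw [complexMGF_ofReal, complexMGF_ofReal, hx]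
    rw [Filter.frequently_iff_seq_forall] at hreal ⊢
    obtain ⟨xs, hx_tendsto, hx_eq⟩ := hreal
    refine ⟨fun n => xs n, ?_, hx_eq⟩
    rw [tendsto_nhdsWithin_iff] at hx_tendsto ⊢
    refine ⟨(Complex.continuous_ofReal.tendsto 0).comp hx_tendsto.1, ?_⟩
    simpa using hx_tendsto.2
  have := Measure.isProbabilityMeasure_map hX
  have := Measure.isProbabilityMeasure_map hY
  refine Measure.ext_of_charFun (funext fun w => ?_)
  have hw := heq (show (w * Complex.I : ℂ) ∈ {z : ℂ | z.re ∈ V} by simpa using ⟨h0, h0'⟩)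
  simp only [complexMGF, mul_right_comm _ Complex.I] at hw
  rw [charFun_apply_real, charFun_apply_real, integral_map hX (by fun_prop),
    integral_map hY (by fun_prop), hw]

end MGFUniqueness

/-! ### Measurability of inverses and projections. -/

section Measurability

variable {α : Type*} [MeasurableSpace α]

lemma measurable_det {κ : Type*} [Fintype κ] [DecidableEq κ] {A : α → Matrix κ κ ℂ}
    (hA : ∀ i j, Measurable fun a => A a i j) : Measurable fun a => (A a).det := by
  simp only [det_apply]
  fun_prop

lemma measurable_inv_apply {κ : Type*} [Fintype κ] [DecidableEq κ] {A : α → Matrix κ κ ℂ}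
    (hA : ∀ i j, Measurable fun a => A a i j) (i j : κ) : Measurable fun a => (A a)⁻¹ i j := by
  simp only [inv_def, Matrix.smul_apply, Ring.inverse_eq_inv', adjugate_apply, smul_eq_mul]
  refine (measurable_det hA).inv.mul (measurable_det fun k l => ?_)
  by_cases hk : k = j
  · subst hk
    simp [updateRow_self]
  · simpa [updateRow_ne hk] using hA k l

lemma measurable_residualProj_apply {ι κ : Type*} [Fintype ι] [DecidableEq ι] [Fintype κ]
    [DecidableEq κ] {Z : α → Matrix ι κ ℂ} (hZ : ∀ i j, Measurable fun a => Z a i j) (i j : ι) :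
    Measurable fun a => residualProj (Z a) i j := by
  have hG : ∀ k l, Measurable fun a => ((Z a)ᴴ * Z a)⁻¹ k l := measurable_inv_apply fun k l => by
    simp only [Matrix.mul_apply, conjTranspose_apply]
    fun_prop
  simp only [residualProj, Matrix.sub_apply, Matrix.mul_apply, conjTranspose_apply]
  refine measurable_const.sub (Finset.measurable_fun_sum _ fun l _ => Measurable.mul ?_ ?_)
  · exact Finset.measurable_fun_sum _ fun k _ => (hZ i k).mul (hG k l)
  · exact continuous_star.measurable.comp (hZ j l)

end Measurability

/-! ### The SNR as a projected squared length. -/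

section ZeroForcing

variable {NR NT : ℕ} [NeZero NT]

lemma mulVec_eq_smul_col_add (A : Matrix (Fin NR) (Fin NT) ℂ) (v : Fin NT → ℂ) :
    A *ᵥ v = v 0 • A.col 0 + interferers A *ᵥ fun j => v j := by
  ext i
  rw [mulVec, dotProduct, Fintype.sum_eq_add_sum_subtype_ne _ 0]
  simp [interferers, mulVec, dotProduct, mul_comm]

/-- With v the first column of (AᴴA)⁻¹, the vector Av is orthogonal to the interferers and has inner
product 1 with the first column h₁. Hence Av = Q₂Av = v₁Q₂h₁, and pairing with h₁ gives the
identity. -/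
lemma inv_gram_mul_form_eq_one (A : Matrix (Fin NR) (Fin NT) ℂ) (h : IsUnit (Aᴴ * A).det)
    (h2 : IsUnit ((interferers A)ᴴ * interferers A).det) :
    (Aᴴ * A)⁻¹ 0 0 * (star (A.col 0) ⬝ᵥ residualProj (interferers A) *ᵥ A.col 0) = 1 := by
  set v := (Aᴴ * A)⁻¹ *ᵥ Pi.single 0 1 with hv
  have hv0 : v 0 = (Aᴴ * A)⁻¹ 0 0 := by simp [hv]
  have hx : Aᴴ *ᵥ (A *ᵥ v) = Pi.single 0 1 := by
    rw [hv, mulVec_mulVec, mulVec_mulVec, mul_nonsing_inv _ h, one_mulVec]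
  have hZx : (interferers A)ᴴ *ᵥ (A *ᵥ v) = 0 := by
    ext j
    have := congrFun hx j
    rw [Pi.single_eq_of_ne j.2] at this
    exact this
  have hQx : residualProj (interferers A) *ᵥ (A *ᵥ v) = A *ᵥ v := by
    rw [residualProj, sub_mulVec, ← mulVec_mulVec, hZx, mulVec_zero, sub_zero, one_mulVec]
  have hQx' : A *ᵥ v = v 0 • residualProj (interferers A) *ᵥ A.col 0 := by
    rw [← hQx, mulVec_eq_smul_col_add A v, mulVec_add, mulVec_smul, mulVec_mulVec, residualProj_mul _ h2,
      zero_mulVec, add_zero]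
  have h1 := congrFun hx 0
  rw [Pi.single_eq_same] at h1
  have h3 : (Aᴴ *ᵥ (A *ᵥ v)) 0 = star (A.col 0) ⬝ᵥ (A *ᵥ v) := rfl
  rw [h3, hQx', dotProduct_smul, smul_eq_mul, hv0] at h1
  exact h1

lemma zfSNR_eq_hermForm (Γs : ℝ) (A : Matrix (Fin NR) (Fin NT) ℂ) (h : IsUnit (Aᴴ * A).det)
    (h2 : IsUnit ((interferers A)ᴴ * interferers A).det) :
    zfSNR Γs A = Γs * hermForm (residualProj (interferers A)) (A.col 0) := by
  have h1 := inv_gram_mul_form_eq_one A h h2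
  rw [← ofReal_hermForm (residualProj_isHermitian _) (residualProj_mul_self _)] at h1
  have h3 := eq_inv_of_mul_eq_one_left h1
  rw [zfSNR, h3, ← Complex.ofReal_inv, Complex.ofReal_re, div_inv_eq_mul]

lemma hermForm_residualProj_add_mulVec {ι κ : Type*} [Fintype ι] [DecidableEq ι] [Fintype κ]
    [DecidableEq κ] (Z : Matrix ι κ ℂ) (h : IsUnit (Zᴴ * Z).det) (x : ι → ℂ) (y : κ → ℂ) :
    hermForm (residualProj Z) (x + Z *ᵥ y) = hermForm (residualProj Z) x := by
  have hQ := residualProj_isHermitian Z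
  have hQ2 := residualProj_mul_self Z
  rw [hermForm, hermForm, hermForm_eq_sqNorm hQ hQ2, hermForm_eq_sqNorm hQ hQ2, mulVec_add,
    mulVec_mulVec, residualProj_mul Z h, zero_mulVec, add_zero]

/-- The projection `Q₂` as a function of the entries of the interfering columns. -/
noncomputable def interferenceProj (k : Fin NR × Fin NT → ℂ) : Matrix (Fin NR) (Fin NR) ℂ :=
  residualProj (interferers (unflatten k))

lemma interferenceProj_interference (A : Matrix (Fin NR) (Fin NT) ℂ) :
    interferenceProj (interference A) = residualProj (interferers A) := by
  unfold interferenceProj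
  congr 1
  ext i j
  simp [interferers, unflatten, interference, j.2]

lemma measurable_interferenceProj_apply (i j : Fin NR) :
    Measurable fun k : Fin NR × Fin NT → ℂ => interferenceProj k i j := by
  have hZ : ∀ (i : Fin NR) (j : {j : Fin NT // j ≠ 0}),
      Measurable fun k : Fin NR × Fin NT → ℂ => interferers (unflatten k) i j := fun i j => by
    simp only [interferers, unflatten, submatrix_apply, of_apply]
    exact measurable_pi_apply _
  unfold interferenceProj
  exact measurable_residualProj_apply hZ i j

/-- Because `w 0 = 1` and the mean has only a first column, the new vector differs from the first
column of `A` by a combination of interferers, which the projection kills. -/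
lemma zfSNR_eq_hermForm_innovation (Γs : ℝ) (A Hd : Matrix (Fin NR) (Fin NT) ℂ)
    (hHd : ∀ i, ∀ j ≠ 0, Hd i j = 0) {w : Fin NT → ℂ} (hw0 : w 0 = 1) (h : IsUnit (Aᴴ * A).det)
    (h2 : IsUnit ((interferers A)ᴴ * interferers A).det) :
    zfSNR Γs A =
      Γs * hermForm (interferenceProj (interference A)) (Hd.col 0 + (A - Hd) *ᵥ w) := by
  have hi : interferers (A - Hd) = interferers A := by
    ext i j
    simp [interferers, hHd i j j.2]
  have hx : Hd.col 0 + (A - Hd) *ᵥ w = A.col 0 + interferers A *ᵥ fun j => w j := by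
    rw [mulVec_eq_smul_col_add, hw0, one_smul, hi, ← add_assoc]
    congr 1
    ext i
    simp
  rw [zfSNR_eq_hermForm Γs A h h2, interferenceProj_interference, hx,
    hermForm_residualProj_add_mulVec _ h2]

end ZeroForcing

/-! ### Regression vector and moment-generating function of the SNR. -/

section Main

variable {Ω : Type*} [MeasurableSpace Ω] {P : Measure Ω} [IsProbabilityMeasure P] {NR NT : ℕ}
  [NeZero NT] {H : Ω → Matrix (Fin NR) (Fin NT) ℂ} {Hd : Matrix (Fin NR) (Fin NT) ℂ}
  {R : Matrix (Fin NT) (Fin NT) ℂ}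

lemma re_inv_zero_zero_pos (hR : R.PosDef) : 0 < (R⁻¹ 0 0).re :=
  (Complex.pos_iff.1 hR.inv.diag_pos).1

/-- The regression vector that decorrelates the intended stream from the interference. -/
lemma exists_regression_vector (hR : R.PosDef) :
    ∃ w : Fin NT → ℂ, w 0 = 1 ∧ R *ᵥ w = Pi.single 0 (((R⁻¹ 0 0).re⁻¹ : ℝ) : ℂ) := by
  have hp := Complex.pos_iff.1 (hR.inv.diag_pos (i := 0))
  have hre : (((R⁻¹ 0 0).re : ℝ) : ℂ) = R⁻¹ 0 0 := Complex.ext rfl (by simpa using hp.2)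
  have h0 : R⁻¹ 0 0 ≠ 0 := hR.inv.diag_pos.ne'
  have hu : IsUnit R.det := (isUnit_iff_isUnit_det R).1 hR.isUnit
  -- The first column of `R⁻¹`, normalised to have first entry 1.
  refine ⟨(R⁻¹ 0 0)⁻¹ • R⁻¹ *ᵥ Pi.single 0 1, ?_, ?_⟩
  · simp [h0]
  · rw [mulVec_smul, mulVec_mulVec, mul_nonsing_inv _ hu, one_mulVec, ← Pi.single_smul,
      Complex.ofReal_inv, hre]
    simp

namespace IsGaussianChannel

/-- Rotating `x` by `U` amounts to replacing the channel `H` by `Uᴴ * H`, which preserves the law of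
the interference. -/
lemma integral_hermForm_interferenceProj_unitary (hR : R.PosSemidef)
    (hH : IsGaussianChannel P H Hd R) (hHd : ∀ i, ∀ j ≠ 0, Hd i j = 0)
    {U : Matrix (Fin NR) (Fin NR) ℂ} (hU : U ∈ unitaryGroup (Fin NR) ℂ) (x : Fin NR → ℂ) (n : ℕ) :
    ∫ k, hermForm (interferenceProj k) (U *ᵥ x) ^ n ∂P.map (fun ω => interference (H ω)) =
      ∫ k, hermForm (interferenceProj k) x ^ n ∂P.map (fun ω => interference (H ω)) := by
  have hU' : Uᴴ ∈ unitaryGroup (Fin NR) ℂ := by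
    rw [mem_unitaryGroup_iff, star_eq_conjTranspose, conjTranspose_conjTranspose]
    exact mem_unitaryGroup_iff'.1 hU
  have hmap := hH.map_interference_unitary hR hHd hU'
  have hmeas : AEMeasurable (fun ω => interference (Uᴴ * H ω)) P := by
    refine AEMeasurable.of_map_ne_zero ?_
    rw [hmap]
    have := Measure.isProbabilityMeasure_map hH.aemeasurable_interference
    exact IsProbabilityMeasure.ne_zero _
  have hF : ∀ y : Fin NR → ℂ, Measurable fun k : Fin NR × Fin NT → ℂ =>
      hermForm (interferenceProj k) y ^ n := fun y =>
    (measurable_hermForm_comp measurable_interferenceProj_apply measurable_const).pow_const n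
  conv_rhs => rw [← hmap]
  rw [integral_map hH.aemeasurable_interference (hF _).aestronglyMeasurable,
    integral_map hmeas (hF _).aestronglyMeasurable]
  refine integral_congr_ae (Filter.Eventually.of_forall fun ω => ?_)
  have e : interferers (Uᴴ * H ω) = Uᴴ * interferers (H ω) := by
    ext i j
    simp [interferers, Matrix.mul_apply]
  simp only [interferenceProj_interference, e]
  rw [residualProj_unitary_mul hU', hermForm_conj, conjTranspose_conjTranspose]

lemma ae_isUnit_det_interferers (hNT : NT ≤ NR) (hR : R.PosDef)
    (hH : IsGaussianChannel P H Hd R) :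
    ∀ᵐ ω ∂P, IsUnit ((interferers (H ω))ᴴ * interferers (H ω)).det := by
  filter_upwards [hH.ae_isUnit_det hNT hR] with ω hω
  exact isUnit_det_gram_submatrix _ hω _ Subtype.val_injective

lemma ae_trace_interferenceProj (hNT : NT ≤ NR) (hR : R.PosDef)
    (hH : IsGaussianChannel P H Hd R) :
    ∀ᵐ k ∂P.map (fun ω => interference (H ω)),
      (interferenceProj k).trace = ((NR - NT + 1 : ℕ) : ℂ) := by
  have hm : MeasurableSet {k : Fin NR × Fin NT → ℂ |
      (interferenceProj k).trace = ((NR - NT + 1 : ℕ) : ℂ)} := by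
    refine measurableSet_eq_fun ?_ measurable_const
    simp only [trace, diag_apply]
    exact Finset.measurable_fun_sum _ fun i _ => measurable_interferenceProj_apply i i
  rw [ae_map_iff hH.aemeasurable_interference hm]
  filter_upwards [hH.ae_isUnit_det_interferers hNT hR] with ω hω
  rw [interferenceProj_interference, trace_residualProj _ hω]
  have hcard : Fintype.card {j : Fin NT // j ≠ 0} = NT - 1 := by
    simp [Fintype.card_subtype_compl]
  have h1 : 1 ≤ NT := NeZero.one_le
  rw [hcard, Fintype.card_fin]
  -- The trace is NR - (NT - 1); both natural subtractions are genuine because 1 ≤ NT ≤ NR.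
  push_cast [Nat.cast_sub hNT, Nat.cast_sub h1]
  ring

lemma ae_zfSNR_eq (hNT : NT ≤ NR) (hR : R.PosDef) (hH : IsGaussianChannel P H Hd R)
    (hHd : ∀ i, ∀ j ≠ 0, Hd i j = 0) (Γs : ℝ) {w : Fin NT → ℂ} (hw0 : w 0 = 1) :
    (fun ω => zfSNR Γs (H ω)) =ᵐ[P] fun ω =>
      Γs * hermForm (interferenceProj (interference (H ω))) (Hd.col 0 + (H ω - Hd) *ᵥ w) := by
  filter_upwards [hH.ae_isUnit_det hNT hR, hH.ae_isUnit_det_interferers hNT hR] with ω h1 h2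
  exact zfSNR_eq_hermForm_innovation Γs _ _ hHd hw0 h1 h2

lemma aemeasurable_zfSNR (hNT : NT ≤ NR) (hR : R.PosDef) (hH : IsGaussianChannel P H Hd R)
    (hHd : ∀ i, ∀ j ≠ 0, Hd i j = 0) (Γs : ℝ) :
    AEMeasurable (fun ω => zfSNR Γs (H ω)) P := by
  obtain ⟨w, hw0, -⟩ := exists_regression_vector hR
  refine AEMeasurable.congr ?_ (hH.ae_zfSNR_eq hNT hR hHd Γs hw0).symm
  have hF : Measurable fun p : (Fin NR → ℂ) × (Fin NR × Fin NT → ℂ) =>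
      Γs * hermForm (interferenceProj p.2) (Hd.col 0 + p.1) :=
    (measurable_hermForm_comp (Q := fun p : (Fin NR → ℂ) × (Fin NR × Fin NT → ℂ) =>
      interferenceProj p.2) (x := fun p => Hd.col 0 + p.1)
      (fun i j => (measurable_interferenceProj_apply i j).comp measurable_snd)
      (measurable_fst.const_add _)).const_mul _
  exact hF.comp_aemeasurable (f := fun ω => ((H ω - Hd) *ᵥ w, interference (H ω)))
    ((hH.aemeasurable_innovation w).prodMk hH.aemeasurable_interference)

/-- The moment-generating function of the zero-forcing SNR. -/
lemma mgf_zfSNR (hNT : NT ≤ NR) (hR : R.PosDef) (hH : IsGaussianChannel P H Hd R)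
    (hHd : ∀ i, ∀ j ≠ 0, Hd i j = 0) (Γs : ℝ) {s : ℝ} (hs : Γs / (R⁻¹ 0 0).re * s < 1) :
    Integrable (fun ω => Real.exp (s * zfSNR Γs (H ω))) P ∧
    mgf (fun ω => zfSNR Γs (H ω)) P s =
      1 / (1 - Γs / (R⁻¹ 0 0).re * s) ^ (NR - NT + 1) *
        kummer1F1 (NR - NT + 1 : ℕ) NR
          (s * Γs / (1 - Γs / (R⁻¹ 0 0).re * s) * sqNorm (Hd.col 0)) := by
  have hρ := re_inv_zero_zero_pos hR
  obtain ⟨w, hw0, hw⟩ := exists_regression_vector hR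
  obtain ⟨c, hc⟩ : ∃ c : ℝ≥0, (c : ℝ) = (R⁻¹ 0 0).re⁻¹ := ⟨⟨_, (inv_pos.2 hρ).le⟩, rfl⟩
  rw [← hc] at hw
  have hc0 : c ≠ 0 := by
    intro h
    rw [h, NNReal.coe_zero] at hc
    exact (inv_pos.2 hρ).ne hc
  -- The Gaussian formula is applied with `u = s * Γs` and variance `c`, so `u * c` is Γ₁s.
  have huc : s * Γs * c = Γs / (R⁻¹ 0 0).re * s := by rw [hc]; ring
  have : Nonempty (Fin NR) := ⟨⟨0, lt_of_lt_of_le (NeZero.pos NT) hNT⟩⟩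
  have := Measure.isProbabilityMeasure_map hH.aemeasurable_interference
  obtain ⟨hI, hE⟩ := exp_hermForm_prod_of_isotropic
    (ν := P.map (fun ω => interference (H ω))) (Q := interferenceProj)
    measurable_interferenceProj_apply (fun k => residualProj_isHermitian _)
    (fun k => residualProj_mul_self _) (hH.ae_trace_interferenceProj hNT hR)
    (fun U hU => hH.integral_hermForm_interferenceProj_unitary hR.posSemidef hHd hU) hc0
    (huc ▸ hs) (Hd.col 0)
  have hpair : AEMeasurable (fun ω => ((H ω - Hd) *ᵥ w, interference (H ω))) P :=
    (hH.aemeasurable_innovation w).prodMk hH.aemeasurable_interference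
  have hmap : P.map (fun ω => ((H ω - Hd) *ᵥ w, interference (H ω))) =
      (gaussianVector (Fin NR) c).prod (P.map (fun ω => interference (H ω))) := by
    rw [← hH.map_innovation hR.posSemidef hw hw0]
    exact (indepFun_iff_map_prod_eq_prod_map_map (hH.aemeasurable_innovation w)
      hH.aemeasurable_interference).1
        (hH.indepFun_innovation_interference hR.posSemidef hHd hw hw0)
  rw [← hmap] at hI hE
  have hae : (fun ω => Real.exp (s * zfSNR Γs (H ω))) =ᵐ[P] fun ω =>
      Real.exp (s * Γs * hermForm (interferenceProj (interference (H ω)))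
        (Hd.col 0 + (H ω - Hd) *ᵥ w)) := by
    filter_upwards [hH.ae_zfSNR_eq hNT hR hHd Γs hw0] with ω hω
    rw [hω, mul_assoc]
  constructor
  · exact (hI.comp_aemeasurable hpair).congr hae.symm
  · rw [integral_map hpair hI.1, huc, Fintype.card_fin] at hE
    rw [mgf, integral_congr_ae hae]
    exact hE

lemma zero_mem_interior_integrableExpSet_zfSNR (hNT : NT ≤ NR) (hR : R.PosDef)
    (hH : IsGaussianChannel P H Hd R) (hHd : ∀ i, ∀ j ≠ 0, Hd i j = 0) (Γs : ℝ) :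
    0 ∈ interior (integrableExpSet (fun ω => zfSNR Γs (H ω)) P) := by
  rw [mem_interior_iff_mem_nhds]
  have h1 : ∀ᶠ s : ℝ in nhds 0, Γs / (R⁻¹ 0 0).re * s < 1 :=
    (continuous_const.mul continuous_id).continuousAt.eventually_lt continuousAt_const (by simp)
  filter_upwards [h1] with s hs using (hH.mgf_zfSNR hNT hR hHd Γs hs).1

end IsGaussianChannel

end Main

theorem mainTheorem1 {Ω : Type*} [MeasurableSpace Ω] (P : Measure Ω) [IsProbabilityMeasure P]
    (NR NT : ℕ) [NeZero NT] (hNT : NT ≤ NR) (Γs : ℝ) (hΓs : 0 < Γs)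
    (R : Matrix (Fin NT) (Fin NT) ℂ) (hR : R.PosDef)
    (Hd : Matrix (Fin NR) (Fin NT) ℂ) (hHd : ∀ i, ∀ j ≠ 0, Hd i j = 0)
    (H : Ω → Matrix (Fin NR) (Fin NT) ℂ) (hH : IsGaussianChannel P H Hd R)
    (N : ℕ) (hN : N = NR - NT + 1)
    (Γ₁ a : ℝ) (hΓ₁ : Γ₁ = Γs / (R⁻¹ 0 0).re)
    (ha : a = (R⁻¹ 0 0).re * ‖WithLp.toLp 2 (Hd.col 0)‖ ^ 2) :
    -- the inverses exist almost surely, and the SNR is the Hermitian form `Γs h₁ᴴ Q₂ h₁`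
    (∀ᵐ ω ∂P, IsUnit ((H ω).conjTranspose * H ω).det ∧
      IsUnit ((interferers (H ω)).conjTranspose * interferers (H ω)).det ∧
      (zfSNR Γs (H ω) : ℂ) =
        Γs * (star ((H ω).col 0) ⬝ᵥ (projQ₂ (H ω)).mulVec ((H ω).col 0))) ∧
    -- the moment generating function
    (∀ s : ℝ, Γ₁ * s < 1 →
      Integrable (fun ω => Real.exp (s * zfSNR Γs (H ω))) P ∧
      mgf (fun ω => zfSNR Γs (H ω)) P s =
        1 / (1 - Γ₁ * s) ^ N * kummer1F1 N NR (a * (Γ₁ * s / (1 - Γ₁ * s)))) ∧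
    -- the law depends on the mean only through the norm of its first column, and on the
    -- transmit-covariance only through the first diagonal entry of its inverse
    (∀ (Ω' : Type*) [MeasurableSpace Ω'] (P' : Measure Ω') [IsProbabilityMeasure P']
      (R' : Matrix (Fin NT) (Fin NT) ℂ) (Hd' : Matrix (Fin NR) (Fin NT) ℂ)
      (H' : Ω' → Matrix (Fin NR) (Fin NT) ℂ),
      R'.PosDef → (∀ i, ∀ j ≠ 0, Hd' i j = 0) → IsGaussianChannel P' H' Hd' R' →
      R'⁻¹ 0 0 = R⁻¹ 0 0 →
      ‖WithLp.toLp 2 (Hd'.col 0)‖ = ‖WithLp.toLp 2 (Hd.col 0)‖ →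
      P'.map (fun ω => zfSNR Γs (H' ω)) = P.map (fun ω => zfSNR Γs (H ω))) := by
  have hρ := re_inv_zero_zero_pos hR
  refine ⟨?_, fun s hs => ?_, fun Ω' _ P' _ R' Hd' H' hR' hHd' hH' hRR hnorm => ?_⟩
  · filter_upwards [hH.ae_isUnit_det hNT hR, hH.ae_isUnit_det_interferers hNT hR] with ω h1 h2
    refine ⟨h1, h2, ?_⟩
    rw [zfSNR_eq_hermForm Γs _ h1 h2, Complex.ofReal_mul,
      ofReal_hermForm (residualProj_isHermitian _) (residualProj_mul_self _)]
    rfl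
  · rw [hΓ₁] at hs ⊢
    obtain ⟨hI, hE⟩ := hH.mgf_zfSNR hNT hR hHd Γs hs
    refine ⟨hI, ?_⟩
    rw [hE, hN, ha, sqNorm_eq_norm]
    congr 2
    -- The arguments of ₁F₁ agree because a Γ₁ = Γs ‖h_{d,1}‖²: the factor [R⁻¹]₁₁ cancels.
    field_simp
  · refine map_eq_of_mgf_eventuallyEq (hH'.aemeasurable_zfSNR hNT hR' hHd' Γs)
      (hH.aemeasurable_zfSNR hNT hR hHd Γs)
      (hH'.zero_mem_interior_integrableExpSet_zfSNR hNT hR' hHd' Γs)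
      (hH.zero_mem_interior_integrableExpSet_zfSNR hNT hR hHd Γs) ?_
    have h1 : ∀ᶠ s : ℝ in nhds 0, Γs / (R⁻¹ 0 0).re * s < 1 :=
      (continuous_const.mul continuous_id).continuousAt.eventually_lt continuousAt_const (by simp)
    filter_upwards [h1] with s hs
    rw [(hH.mgf_zfSNR hNT hR hHd Γs hs).2, (hH'.mgf_zfSNR hNT hR' hHd' Γs (by rwa [hRR])).2, hRR,
      sqNorm_eq_norm, sqNorm_eq_norm, hnorm]
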